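/- Let $(X,d)$ be a separable metric space (not necessarily complete), let $\mathrm{Lip}(X)$ be the space of real-valued Lipschitz functions on $X$, $\mathrm{Lip}_b(X)$ its subspace of bounded functions, $\mathrm{Lip}_1(X)$ the set of $1$-Lipschitz functions, and $\mathrm{Lip}(\pi)$ the least Lipschitz constant of $\pi$. *Currents.* A metric $1$-current on $X$, written $T\in\mathbf M_1(X)$, is a bilinear functional $T:\mathrm{Lip}_b(X)\times\mathrm{Lip}(X)\to\mathbb R$ such that: (i) there is a finite Borel measure $\mu$ on $X$ with $|T(f,\pi)|\le \mathrm{Lip}(\pi)\int_X|f|\,d\mu$ for all $f,\pi$; (ii) $T(f,\pi_j)\to T(f,\pi)$ whenever $\pi_j\to\pi$ pointwise and $\sup_j\mathrm{Lip}(\pi_j)<\infty$; (iii) $T(f,\pi)=0$ whenever $\pi$ is constant on a neighbourhood of the support of $f$. The minimal measure $\mu$ in (i) is the mass measure $\|T\|$, and $\mathbf M(T)=\|T\|(X)$ is the mass. The boundary of $T$ is $\partial T(f)=T(1,f)$, and $\|\partial T\|_{\mathrm{KR}}=\sup\{T(1,f): f\in\mathrm{Lip}_1(X)\}$. *Rectifiability.*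 A subset of $X$ is $1$-rectifiable if it is the image of a bounded subset of $\mathbb R$ under a Lipschitz map, and countably $1$-rectifiable if it is a countable union of $1$-rectifiable sets. A current $R\in\mathbf M_1(X)$ is rectifiable, written $R\in\mathcal R_1(X)$, if $\|R\|$ is concentrated on a countably $1$-rectifiable set and is absolutely continuous with respect to the Hausdorff measure $\mathcal H^1$. *Piecewise quasiconvexity.* $X$ is piecewise quasiconvex with constant $c\ge1$ if for all $x,y\in X$ and $\varepsilon>0$ there are $m\ge1$, pairs $(x_1,y_1),\dots,(x_m,y_m)$ in $X$ and Lipschitz curves $\theta_1,\dots,\theta_m:[0,1]\to X$ with $\theta_i(0)=x_i$, $\theta_i(1)=y_i$, $$d(x,x_1)+d(y_m,y)+\sum_{i=1}^{m-1}d(x_{i+1},y_i)<\varepsilon,\qquad \sum_{i=1}^m\ell(\theta_i)\le c\,d(x,y),$$ where $\ell(\theta)=\int_0^1\limsup_{h\to0^+}\frac{d(\theta(t+h),\theta(t))}{h}\,dt$. **Corollary (Filling by rectifiable currents).** Let $X$ be a separable metric space that is piecewise quasiconvex with constant $c\ge1$, and let $T\in\mathbf M_1(X)$. Then for every $\varepsilon>0$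 there exist $C\in\mathbf M_1(X)$ and $R\in\mathcal R_1(X)$ such that 1. $\partial C=0$, 2. $T=C+R$, 3. $\mathbf M(C)\le\mathbf M(T)+c\,\|\partial T\|_{\mathrm{KR}}+\varepsilon$, 4. $\mathbf M(R)\le c\,\|\partial T\|_{\mathrm{KR}}+\varepsilon$. -/

import Mathlib

open Filter Topology MeasureTheory
open scoped NNReal ENNReal

noncomputable section

namespace MetricCurrents

/-- `Lip(X)`: the vector space of real-valued Lipschitz functions on `X`. -/
def Lip (X : Type*) [MetricSpace X] : Submodule ℝ (X → ℝ) where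
  carrier := {f | ∃ K : ℝ≥0, LipschitzWith K f}
  add_mem' := by
    rintro f g ⟨K, hf⟩ ⟨L, hg⟩
    exact ⟨K + L, hf.add hg⟩
  zero_mem' := ⟨0, LipschitzWith.const 0⟩
  smul_mem' := by
    rintro a f ⟨K, hf⟩
    refine ⟨‖a‖₊ * K, LipschitzWith.of_dist_le_mul fun x y => ?_⟩
    have h := mul_le_mul_of_nonneg_left (hf.dist_le_mul x y) (abs_nonneg a)
    simpa [Real.dist_eq, ← mul_sub, abs_mul, mul_assoc] using h

/-- `Lip_b(X)`: the subspace of bounded Lipschitz functions. -/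
def LipB (X : Type*) [MetricSpace X] : Submodule ℝ (X → ℝ) where
  carrier := {f | f ∈ Lip X ∧ ∃ M : ℝ, ∀ x, |f x| ≤ M}
  add_mem' := by
    rintro f g ⟨hf, M, hM⟩ ⟨hg, N, hN⟩
    exact ⟨(Lip X).add_mem hf hg, M + N, fun x =>
      (abs_add_le (f x) (g x)).trans (add_le_add (hM x) (hN x))⟩
  zero_mem' := ⟨(Lip X).zero_mem, 0, fun x => by simp⟩
  smul_mem' := by
    rintro a f ⟨hf, M, hM⟩
    refine ⟨(Lip X).smul_mem a hf, |a| * M, fun x => ?_⟩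
    simpa [abs_mul] using mul_le_mul_of_nonneg_left (hM x) (abs_nonneg a)

theorem lipB_le_lip (X : Type*) [MetricSpace X] : LipB X ≤ Lip X := fun _ hf => hf.1

/-- The constant function `1`, as an element of `Lip_b(X)`. -/
def oneB (X : Type*) [MetricSpace X] : LipB X :=
  ⟨fun _ => 1, ⟨0, LipschitzWith.const 1⟩, 1, fun _ => by simp⟩

/-- Bilinear functionals `(f, π) ↦ T(f, π)` on the metric `1`-forms
`𝒟¹(X) = Lip_b(X) × Lip(X)`. -/
abbrev Functional (X : Type*) [MetricSpace X] : Type _ := LipB X →ₗ[ℝ] Lip X →ₗ[ℝ] ℝ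

section Currents

variable {X : Type*} [MetricSpace X]

/-- `|T(f, π)| ≤ Lip(π) ∫ |f| dμ` for all `(f, π) ∈ 𝒟¹(X)`; since `Lip(π)` is the least Lipschitz
constant of `π`, the bound is stated for every Lipschitz constant `K` of `π`. -/
def MassBound [MeasurableSpace X] (T : Functional X) (μ : Measure X) : Prop :=
  ∀ (f : LipB X) (π : Lip X) (K : ℝ≥0), LipschitzWith K (π : X → ℝ) →
    |T f π| ≤ K * ∫ x, |(f : X → ℝ) x| ∂μ

/-- `T` is a metric `1`-current on `X`, that is `T ∈ 𝐌₁(X)`. -/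
structure IsCurrent [MeasurableSpace X] (T : Functional X) : Prop where
  finite_mass : ∃ μ : Measure X, IsFiniteMeasure μ ∧ MassBound T μ
  continuity : ∀ (f : LipB X) (π : ℕ → Lip X) (π' : Lip X) (K : ℝ≥0),
    (∀ j, LipschitzWith K (π j : X → ℝ)) →
    (∀ x, Tendsto (fun j => (π j : X → ℝ) x) atTop (𝓝 ((π' : X → ℝ) x))) →
    Tendsto (fun j => T f (π j)) atTop (𝓝 (T f π'))
  locality : ∀ (f : LipB X) (π : Lip X) (U : Set X) (a : ℝ), IsOpen U →
    tsupport (f : X → ℝ) ⊆ U → (∀ x ∈ U, (π : X → ℝ) x = a) → T f π = 0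

/-- The mass measure `‖T‖`: the minimal finite Borel measure with
`|T(f, π)| ≤ Lip(π) ∫ |f| dμ`, written as the infimum of all such measures. -/
def massMeasure [MeasurableSpace X] (T : Functional X) : Measure X :=
  sInf {μ : Measure X | IsFiniteMeasure μ ∧ MassBound T μ}

/-- The mass `𝐌(T) = ‖T‖(X)`. -/
def mass [MeasurableSpace X] (T : Functional X) : ℝ≥0∞ := massMeasure T Set.univ

/-- The boundary `∂T : 𝒟⁰(X) = Lip_b(X) → ℝ`, `∂T(f) = T(1, f)`. -/
def boundary (T : Functional X) : LipB X →ₗ[ℝ] ℝ :=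
  (T (oneB X)).comp (Submodule.inclusion (lipB_le_lip X))

/-- The Kantorovich-Rubinstein norm `‖∂T‖_KR = sup {∂T(f) : f ∈ Lip₁(X)}`, where
`∂T(f) = T(1, f)` for every (possibly unbounded) Lipschitz function `f`. The set of values is
symmetric about `0`, so only the non-negative values matter. -/
def krBoundary (T : Functional X) : ℝ≥0∞ :=
  ⨆ (f : Lip X) (_ : LipschitzWith 1 (f : X → ℝ)), ENNReal.ofReal (T (oneB X) f)

/-- A `1`-rectifiable set: the image of a bounded subset of `ℝ` under a Lipschitz map. -/
def IsRectifiableSet (E : Set X) : Prop :=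
  ∃ (B : Set ℝ) (γ : B → X) (K : ℝ≥0),
    Bornology.IsBounded B ∧ LipschitzWith K γ ∧ Set.range γ = E

/-- A countably `1`-rectifiable set: a countable union of `1`-rectifiable sets. -/
def IsCountablyRectifiableSet (S : Set X) : Prop :=
  ∃ E : ℕ → Set X, (∀ n, IsRectifiableSet (E n)) ∧ S = ⋃ n, E n

/-- `R ∈ ℛ₁(X)`: a metric `1`-current whose mass measure is concentrated on a countably
`1`-rectifiable set and absolutely continuous with respect to `ℋ¹`. -/
structure IsRectifiableCurrent [MeasurableSpace X] [BorelSpace X] (R : Functional X) : Prop where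
  isCurrent : IsCurrent R
  concentrated : ∃ S : Set X, IsCountablyRectifiableSet S ∧ massMeasure R Sᶜ = 0
  absolutelyContinuous : massMeasure R ≪ μH[1]

/-- The metric speed `|θ̇|(t) = limsup_{h → 0+} d(θ(t + h), θ(t)) / h`. -/
def metricSpeed (θ : ℝ → X) (t : ℝ) : ℝ≥0∞ :=
  limsup (fun h : ℝ => edist (θ (t + h)) (θ t) / ENNReal.ofReal h) (𝓝[>] 0)

/-- The length `ℓ(θ) = ∫₀¹ |θ̇|(t) dt` of a curve on `[0, 1]`; it depends only on the
restriction of `θ` to `[0, 1]`. -/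
def curveLength (θ : ℝ → X) : ℝ≥0∞ := ∫⁻ t in Set.Ioo (0 : ℝ) 1, metricSpeed θ t

end Currents

/-- `X` is piecewise quasiconvex with constant `c`. The pairs `(x₁, y₁), …, (x_{m+1}, y_{m+1})`
are indexed by `Fin (m + 1)`; a Lipschitz curve `[0, 1] → X` is a map `ℝ → X` that is Lipschitz
on `[0, 1]`. -/
def PiecewiseQuasiconvex (X : Type*) [MetricSpace X] (c : ℝ) : Prop :=
  1 ≤ c ∧ ∀ (x y : X) (ε : ℝ), 0 < ε →
    ∃ (m : ℕ) (p q : Fin (m + 1) → X) (θ : Fin (m + 1) → ℝ → X),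
      dist x (p 0) + dist (q (Fin.last m)) y
        + ∑ i : Fin m, dist (p i.succ) (q i.castSucc) < ε ∧
      (∀ i, ∃ K : ℝ≥0, LipschitzOnWith K (θ i) (Set.Icc 0 1)) ∧
      (∀ i, θ i 0 = p i ∧ θ i 1 = q i) ∧
      ∑ i, curveLength (θ i) ≤ ENNReal.ofReal (c * dist x y)

end MetricCurrents

end

noncomputable section

set_option linter.unusedSectionVars false

namespace MetricCurrents

/-! ### The current carried by a Lipschitz curve, and its metric derivative. -/

section CurveCurrents

variable {X : Type*} [MetricSpace X]

/-! Everything reduces to the functional φ = T(1, ·) on Lipschitz functions. If R is rectifiable,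
has mass at most c‖∂T‖_KR + ε and satisfies R(1, ·) = φ, then C = T − R has no boundary and its mass
is controlled by subadditivity. Only two properties of φ matter for building R: |φ(f)| ≤ A Lip(f)
with A = ‖∂T‖_KR, and continuity along pointwise convergent, uniformly Lipschitz sequences.

Continuity implies that, up to a small error, φ sees f only at finitely many points of a dense
sequence (`LipContinuous.exists_finite_determination`). Hahn–Banach then makes φ close to a
combination of difference quotients between these points, with total weight at most A
(`LipBound.exists_approx`). Piecewise quasiconvexity replaces each difference quotient by curves of
length at most c times the distance, with negligible jumps. The weighted curves form a current of
mass at most cA whose boundary misses φ by a functional of arbitrarily small Lipschitz bound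
(`PiecewiseQuasiconvex.exists_approx`). That remainder is again continuous, so the construction is
iterated and summed (`PiecewiseQuasiconvex.exists_filling`). No limit of curves is ever taken, hence
completeness plays no role.

A curve is rectifiable as a current because the push-forward of its metric derivative bounds its
mass, lives on the curve and ignores `μH[1]`-null sets (`curveMeasure_absolutelyContinuous`).

Since ‖R‖ is an infimum, one explicit bounding measure controls it. The estimate for C also needs a
measure that bounds T and has total mass close to 𝐌(T); it is obtained by gluing
(`IsCurrent.exists_massBound_le`). -/

theorem _root_.LipschitzWith.absolutelyContinuousOnInterval {f : ℝ → ℝ} {K : ℝ≥0}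
    (hf : LipschitzWith K f) (a b : ℝ) : AbsolutelyContinuousOnInterval f a b :=
  (hf.lipschitzOnWith (s := Set.uIcc a b)).absolutelyContinuousOnInterval

theorem LipB.exists_abs_le (f : LipB X) : ∃ M : ℝ, 0 ≤ M ∧ ∀ x, |(f : X → ℝ) x| ≤ M := by
  obtain ⟨M, hM⟩ := f.2.2
  exact ⟨|M|, abs_nonneg M, fun x => (hM x).trans (le_abs_self M)⟩

theorem abs_deriv_le_of_lipschitzWith {g : ℝ → ℝ} {K : ℝ≥0} (hg : LipschitzWith K g) (t : ℝ) :
    |deriv g t| ≤ K := by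
  simpa using norm_deriv_le_of_lipschitz (x₀ := t) hg

theorem intervalIntegrable_curve {θ : ℝ → X} (hθ : ∃ L : ℝ≥0, LipschitzWith L θ) (f : LipB X)
    (π : Lip X) (a b : ℝ) : IntervalIntegrable
      (fun t => (f : X → ℝ) (θ t) * deriv (fun s => (π : X → ℝ) (θ s)) t) volume a b := by
  obtain ⟨L, hL⟩ := hθ
  obtain ⟨K, hK⟩ := π.2
  obtain ⟨F, hF⟩ := f.2.1
  exact (((hK.comp hL).absolutelyContinuousOnInterval a b).intervalIntegrable_deriv).continuousOn_mul
    (hF.continuous.comp hL.continuous).continuousOn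

/-- The current `[θ](f, π) = ∫₀¹ f(θ(t)) (π ∘ θ)'(t) dt` of a Lipschitz curve. -/
def curveFunctional (θ : ℝ → X) (hθ : ∃ L : ℝ≥0, LipschitzWith L θ) : Functional X :=
  LinearMap.mk₂ ℝ
    (fun (f : LipB X) (π : Lip X) =>
      ∫ t in (0 : ℝ)..1, (f : X → ℝ) (θ t) * deriv (fun s => (π : X → ℝ) (θ s)) t)
    (by
      intro f g π
      rw [← intervalIntegral.integral_add (intervalIntegrable_curve hθ f π 0 1)
        (intervalIntegrable_curve hθ g π 0 1)]
      simp [add_mul])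
    (by
      intro a f π
      rw [smul_eq_mul, ← intervalIntegral.integral_const_mul]
      simp [mul_assoc])
    (by
      intro f π π'
      have hI := intervalIntegrable_curve hθ f π 0 1
      have hI' := intervalIntegrable_curve hθ f π' 0 1
      obtain ⟨L, hL⟩ := hθ
      obtain ⟨K, hK⟩ := π.2
      obtain ⟨K', hK'⟩ := π'.2
      rw [← intervalIntegral.integral_add hI hI']
      refine intervalIntegral.integral_congr_ae ?_
      filter_upwards [(hK.comp hL).ae_differentiableAt_real,
        (hK'.comp hL).ae_differentiableAt_real] with t h1 h2 _
      have : deriv (fun s => ((π + π' : Lip X) : X → ℝ) (θ s)) t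
          = deriv ((π : X → ℝ) ∘ θ) t + deriv ((π' : X → ℝ) ∘ θ) t := (h1.hasDerivAt.add h2.hasDerivAt).deriv
      rw [this, mul_add]
      rfl)
    (by
      intro a f π
      rw [smul_eq_mul, ← intervalIntegral.integral_const_mul]
      refine intervalIntegral.integral_congr fun t _ => ?_
      have : deriv (fun s => ((a • π : Lip X) : X → ℝ) (θ s)) t
          = a * deriv (fun s => (π : X → ℝ) (θ s)) t :=
        deriv_const_mul_field a
      simp only [this]
      ring)

theorem curveFunctional_apply (θ : ℝ → X) (hθ : ∃ L : ℝ≥0, LipschitzWith L θ) (f : LipB X)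
    (π : Lip X) : curveFunctional θ hθ f π =
      ∫ t in (0 : ℝ)..1, (f : X → ℝ) (θ t) * deriv (fun s => (π : X → ℝ) (θ s)) t := rfl

theorem curveFunctional_oneB (θ : ℝ → X) (hθ : ∃ L : ℝ≥0, LipschitzWith L θ) (π : Lip X) :
    curveFunctional θ hθ (oneB X) π = (π : X → ℝ) (θ 1) - (π : X → ℝ) (θ 0) := by
  obtain ⟨L, hL⟩ := hθ
  obtain ⟨K, hK⟩ := π.2
  have := ((hK.comp hL).absolutelyContinuousOnInterval 0 1).integral_deriv_eq_sub
  simpa [curveFunctional_apply, oneB, Function.comp_def] using this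

/-- Pointwise convergence of π_j says nothing about derivatives, so integration by parts moves the
derivative onto f ∘ θ; dominated convergence then applies. -/
theorem curveFunctional_continuity (θ : ℝ → X) (hθ : ∃ L : ℝ≥0, LipschitzWith L θ) (f : LipB X)
    (π : ℕ → Lip X) (π' : Lip X) (K : ℝ≥0) (hπ : ∀ j, LipschitzWith K (π j : X → ℝ))
    (hlim : ∀ x, Tendsto (fun j => (π j : X → ℝ) x) atTop (𝓝 ((π' : X → ℝ) x))) :
    Tendsto (fun j => curveFunctional θ hθ f (π j)) atTop (𝓝 (curveFunctional θ hθ f π')) := by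
  obtain ⟨L, hL⟩ := hθ
  obtain ⟨K', hK'⟩ := π'.2
  obtain ⟨F, hF⟩ := f.2.1
  have key : ∀ (ρ : Lip X) (C : ℝ≥0), LipschitzWith C (ρ : X → ℝ) →
      curveFunctional θ ⟨L, hL⟩ f ρ =
        (f : X → ℝ) (θ 1) * (ρ : X → ℝ) (θ 1) - (f : X → ℝ) (θ 0) * (ρ : X → ℝ) (θ 0)
        - ∫ t in (0 : ℝ)..1, deriv (fun s => (f : X → ℝ) (θ s)) t * (ρ : X → ℝ) (θ t) := by
    intro ρ C hρ
    exact ((hF.comp hL).absolutelyContinuousOnInterval 0 1).integral_mul_deriv_eq_deriv_mul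
      ((hρ.comp hL).absolutelyContinuousOnInterval 0 1)
  rw [key π' K' hK']
  simp_rw [fun j => key (π j) K (hπ j)]
  refine (((hlim _).const_mul _).sub ((hlim _).const_mul _)).sub ?_
  -- Convergence at the single point θ(0) and the common Lipschitz constant bound all π_j ∘ θ on [0,
  -- 1].
  obtain ⟨B, hB⟩ := (hlim (θ 0)).abs.bddAbove_range
  refine intervalIntegral.tendsto_integral_filter_of_dominated_convergence
    (fun _ => (F * L : ℝ≥0) * (B + K * L)) ?_ ?_ ?_ ?_
  · refine Eventually.of_forall fun j => ?_
    exact ((measurable_deriv _).mul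
      ((hπ j).continuous.comp hL.continuous).measurable).aestronglyMeasurable
  · refine Eventually.of_forall fun j => ae_of_all _ fun t ht => ?_
    rw [Set.uIoc_of_le zero_le_one] at ht
    rw [norm_mul]
    have h1 : |(π j : X → ℝ) (θ 0)| ≤ B := hB ⟨j, rfl⟩
    have h2 : |(π j : X → ℝ) (θ t) - (π j : X → ℝ) (θ 0)| ≤ K * L := by
      have := ((hπ j).comp hL).dist_le_mul t 0
      rw [Real.dist_eq, Real.dist_eq, sub_zero, abs_of_pos ht.1] at this
      refine this.trans ?_
      push_cast
      exact mul_le_of_le_one_right (by positivity) ht.2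
    have h3 : |(π j : X → ℝ) (θ t)| ≤ B + K * L := by
      have := abs_add_le ((π j : X → ℝ) (θ 0)) ((π j : X → ℝ) (θ t) - (π j : X → ℝ) (θ 0))
      rw [add_sub_cancel] at this
      linarith
    exact mul_le_mul (abs_deriv_le_of_lipschitzWith (hF.comp hL) t) h3 (abs_nonneg _)
      (by positivity)
  · simp
  · exact ae_of_all _ fun t _ => (hlim _).const_mul _

theorem curveFunctional_locality (θ : ℝ → X) (hθ : ∃ L : ℝ≥0, LipschitzWith L θ) (f : LipB X)
    (π : Lip X) (U : Set X) (a : ℝ) (hU : IsOpen U) (hf : tsupport (f : X → ℝ) ⊆ U)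
    (hπ : ∀ x ∈ U, (π : X → ℝ) x = a) : curveFunctional θ hθ f π = 0 := by
  obtain ⟨L, hL⟩ := hθ
  rw [curveFunctional_apply]
  convert intervalIntegral.integral_zero with t
  by_cases h : (f : X → ℝ) (θ t) = 0
  · rw [h, zero_mul]
  · have hev : (fun s => (π : X → ℝ) (θ s)) =ᶠ[𝓝 t] fun _ => a := by
      filter_upwards [hL.continuous.continuousAt (hU.mem_nhds (hf (subset_tsupport _ h)))]
        with s hs using hπ _ hs
    rw [hev.deriv_eq, deriv_const, mul_zero]

/-- The metric derivative of `θ`, computed from the distances to a dense sequence `x`. -/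
def metricDeriv (x : ℕ → X) (θ : ℝ → X) (t : ℝ) : ℝ :=
  ⨆ n, |deriv (fun s => dist (x n) (θ s)) t|

theorem lipschitzWith_dist_curve {θ : ℝ → X} {L : ℝ≥0} (hL : LipschitzWith L θ) (y : X) :
    LipschitzWith L (fun s => dist y (θ s)) := by
  simpa [Function.comp_def] using (LipschitzWith.dist_right y).comp hL

theorem bddAbove_abs_deriv_dist (x : ℕ → X) {θ : ℝ → X} {L : ℝ≥0} (hL : LipschitzWith L θ)
    (t : ℝ) : BddAbove (Set.range fun n => |deriv (fun s => dist (x n) (θ s)) t|) :=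
  ⟨L, by rintro _ ⟨n, rfl⟩; exact abs_deriv_le_of_lipschitzWith (lipschitzWith_dist_curve hL _) t⟩

theorem abs_deriv_dist_le_metricDeriv (x : ℕ → X) {θ : ℝ → X} {L : ℝ≥0} (hL : LipschitzWith L θ)
    (t : ℝ) (n : ℕ) : |deriv (fun s => dist (x n) (θ s)) t| ≤ metricDeriv x θ t :=
  le_ciSup (bddAbove_abs_deriv_dist x hL t) n

theorem metricDeriv_nonneg (x : ℕ → X) (θ : ℝ → X) (t : ℝ) : 0 ≤ metricDeriv x θ t :=
  Real.iSup_nonneg fun _ => abs_nonneg _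

theorem metricDeriv_le (x : ℕ → X) {θ : ℝ → X} {L : ℝ≥0} (hL : LipschitzWith L θ) (t : ℝ) :
    metricDeriv x θ t ≤ L :=
  ciSup_le fun _ => abs_deriv_le_of_lipschitzWith (lipschitzWith_dist_curve hL _) t

theorem measurable_metricDeriv (x : ℕ → X) (θ : ℝ → X) :
    Measurable (metricDeriv x θ) := by
  unfold metricDeriv
  exact Measurable.iSup fun n => (measurable_deriv _).abs

theorem locallyIntegrable_metricDeriv (x : ℕ → X) {θ : ℝ → X} {L : ℝ≥0} (hL : LipschitzWith L θ) :
    LocallyIntegrable (metricDeriv x θ) volume := by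
  refine (locallyIntegrable_const (L : ℝ)).mono (measurable_metricDeriv x θ).aestronglyMeasurable
    (ae_of_all _ fun t => ?_)
  rw [Real.norm_of_nonneg (metricDeriv_nonneg _ _ _), Real.norm_of_nonneg L.coe_nonneg]
  exact metricDeriv_le x hL t

theorem intervalIntegrable_metricDeriv (x : ℕ → X) {θ : ℝ → X} {L : ℝ≥0}
    (hL : LipschitzWith L θ) (a b : ℝ) : IntervalIntegrable (metricDeriv x θ) volume a b :=
  ((locallyIntegrable_metricDeriv x hL).integrableOn_isCompact
    isCompact_uIcc).intervalIntegrable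

/-- Integrate the derivative of each s ↦ d(x_n, θ(s)), then let x_n approach θ(s) by density. -/
theorem dist_le_integral_metricDeriv {x : ℕ → X} (hx : DenseRange x) {θ : ℝ → X} {L : ℝ≥0}
    (hL : LipschitzWith L θ) {s t : ℝ} (hst : s ≤ t) :
    dist (θ s) (θ t) ≤ ∫ r in s..t, metricDeriv x θ r := by
  have hn : ∀ n, dist (x n) (θ t) - dist (x n) (θ s) ≤ ∫ r in s..t, metricDeriv x θ r := by
    intro n
    have hac := (lipschitzWith_dist_curve hL (x n)).absolutelyContinuousOnInterval s t
    rw [← hac.integral_deriv_eq_sub]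
    exact intervalIntegral.integral_mono_on hst hac.intervalIntegrable_deriv
      (intervalIntegrable_metricDeriv x hL s t) fun r _ =>
        (le_abs_self _).trans (abs_deriv_dist_le_metricDeriv x hL r n)
  have hcl : IsClosed {y : X | dist y (θ t) - dist y (θ s) ≤ ∫ r in s..t, metricDeriv x θ r} :=
    isClosed_le (by fun_prop) continuous_const
  have := hcl.closure_subset_iff.2 (Set.range_subset_iff.2 hn) (hx (θ s))
  simpa using this

/-- At a Lebesgue point of the metric derivative, divide the integral bound on d(θ(s), θ(t)) by s −
t and let s decrease to t. -/
theorem ae_abs_deriv_comp_le_metricDeriv {x : ℕ → X} (hx : DenseRange x) {θ : ℝ → X} {L : ℝ≥0}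
    (hL : LipschitzWith L θ) {π : X → ℝ} {K : ℝ≥0} (hπ : LipschitzWith K π) :
    ∀ᵐ t, |deriv (fun s => π (θ s)) t| ≤ K * metricDeriv x θ t := by
  filter_upwards [LocallyIntegrable.ae_hasDerivAt_integral (locallyIntegrable_metricDeriv x hL),
    (hπ.comp hL).ae_differentiableAt_real] with t ht hd
  have h1 := (hasDerivAt_iff_tendsto_slope.1 hd.hasDerivAt).abs.mono_left
    (nhdsWithin_mono t (s := Set.Ioi t) fun y (hy : t < y) => hy.ne')
  have h2 := ((hasDerivAt_iff_tendsto_slope.1 (ht t)).const_mul (K : ℝ)).mono_left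
    (nhdsWithin_mono t (s := Set.Ioi t) fun y (hy : t < y) => hy.ne')
  refine le_of_tendsto_of_tendsto h1 h2 ?_
  filter_upwards [self_mem_nhdsWithin] with s (hs : t < s)
  have hpos : 0 < s - t := sub_pos.2 hs
  rw [slope_def_field, slope_def_field, abs_div, abs_of_pos hpos, intervalIntegral.integral_same,
    sub_zero, ← mul_div_assoc]
  gcongr
  have h3 := hπ.dist_le_mul (θ s) (θ t)
  rw [Real.dist_eq, dist_comm (θ s)] at h3
  exact h3.trans (by gcongr; exact dist_le_integral_metricDeriv hx hL hs.le)

/-- By the triangle inequality, each distance function along θ varies no faster than θ. Where it is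
not differentiable, `deriv` is 0 and the bound is trivial. -/
theorem ofReal_metricDeriv_le_metricSpeed (x : ℕ → X) (θ : ℝ → X) (t : ℝ) :
    ENNReal.ofReal (metricDeriv x θ t) ≤ metricSpeed θ t := by
  have hn : ∀ n, ENNReal.ofReal |deriv (fun s => dist (x n) (θ s)) t| ≤ metricSpeed θ t := by
    intro n
    by_cases hd : DifferentiableAt ℝ (fun s => dist (x n) (θ s)) t
    · have h1 := (hasDerivAt_iff_tendsto_slope_zero.1 hd.hasDerivAt).abs.mono_left
        (nhdsWithin_mono (0 : ℝ) (s := Set.Ioi 0) fun y (hy : 0 < y) => hy.ne')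
      rw [← (ENNReal.tendsto_ofReal h1).limsup_eq]
      refine limsup_le_limsup ?_
      filter_upwards [self_mem_nhdsWithin] with h (hh : 0 < h)
      rw [edist_dist, ← ENNReal.ofReal_div_of_pos hh]
      refine ENNReal.ofReal_le_ofReal ?_
      rw [smul_eq_mul, abs_mul, abs_inv, abs_of_pos hh, inv_mul_eq_div]
      gcongr
      rw [dist_comm (x n), dist_comm (x n)]
      exact abs_dist_sub_le _ _ _
    · simp [deriv_zero_of_not_differentiableAt hd]
  by_cases htop : metricSpeed θ t = ∞
  · simp [htop]
  · rw [ENNReal.ofReal_le_iff_le_toReal htop]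
    exact ciSup_le fun n => (ENNReal.ofReal_le_iff_le_toReal htop).1 (hn n)

end CurveCurrents

/-! ### Mass bound of a curve and its absolute continuity with respect to `μH[1]`. -/

section CurveMeasures

variable {X : Type*} [MetricSpace X] [MeasurableSpace X] [BorelSpace X]

/-- The push-forward under `θ` of its metric derivative, a mass bound for the current of `θ`. -/
def curveMeasure (x : ℕ → X) (θ : ℝ → X) : Measure X :=
  ((volume.restrict (Set.Ioc (0 : ℝ) 1)).withDensity
    fun t => ((metricDeriv x θ t).toNNReal : ℝ≥0∞)).map θ

theorem curveMeasure_univ_le (x : ℕ → X) {θ : ℝ → X} (hθ : Continuous θ) :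
    curveMeasure x θ Set.univ ≤ curveLength θ := by
  rw [curveMeasure, Measure.map_apply hθ.measurable .univ, Set.preimage_univ,
    withDensity_apply _ .univ, Measure.restrict_univ, curveLength,
    restrict_Ioo_eq_restrict_Ioc]
  exact lintegral_mono fun t => ofReal_metricDeriv_le_metricSpeed x θ t

theorem isFiniteMeasure_curveMeasure (x : ℕ → X) {θ : ℝ → X} {L : ℝ≥0}
    (hL : LipschitzWith L θ) : IsFiniteMeasure (curveMeasure x θ) := by
  refine ⟨?_⟩
  rw [curveMeasure, Measure.map_apply hL.continuous.measurable .univ, Set.preimage_univ,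
    withDensity_apply _ .univ, Measure.restrict_univ]
  calc _ ≤ ∫⁻ _ in Set.Ioc (0 : ℝ) 1, (L : ℝ≥0∞) := lintegral_mono fun t => by
        exact ENNReal.coe_le_coe.2 <| Real.toNNReal_le_iff_le_coe.2 (metricDeriv_le x hL t)
    _ < ∞ := by simp

theorem massBound_curveFunctional {x : ℕ → X} (hx : DenseRange x) {θ : ℝ → X}
    (hθ : ∃ L : ℝ≥0, LipschitzWith L θ) :
    MassBound (curveFunctional θ hθ) (curveMeasure x θ) := by
  intro f π K hK
  have hI := intervalIntegrable_curve hθ f π 0 1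
  obtain ⟨L, hL⟩ := hθ
  obtain ⟨F, hF⟩ := f.2.1
  obtain ⟨M, hM⟩ := f.2.2
  have hfm : Measurable fun t => |(f : X → ℝ) (θ t)| :=
    (hF.continuous.comp hL.continuous).abs.measurable
  rw [curveMeasure, integral_map hL.continuous.aemeasurable
    hF.continuous.abs.aestronglyMeasurable,
    integral_withDensity_eq_integral_smul (measurable_metricDeriv x θ).real_toNNReal,
    curveFunctional_apply, ← integral_const_mul, ← Real.norm_eq_abs]
  refine (intervalIntegral.norm_integral_le_integral_norm zero_le_one).trans ?_
  rw [intervalIntegral.integral_of_le zero_le_one]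
  refine integral_mono_ae ?_ ?_ ?_
  · exact ((intervalIntegrable_iff_integrableOn_Ioc_of_le zero_le_one).1 hI).norm
  · refine Integrable.const_mul ?_ _
    refine Integrable.of_bound (C := L * M)
      ((measurable_metricDeriv x θ).real_toNNReal.smul hfm).aestronglyMeasurable
      (ae_of_all _ fun t => ?_)
    rw [NNReal.smul_def, smul_eq_mul, norm_mul, Real.coe_toNNReal _ (metricDeriv_nonneg x θ t),
      Real.norm_of_nonneg (metricDeriv_nonneg x θ t), Real.norm_eq_abs, abs_abs]
    exact mul_le_mul (metricDeriv_le x hL t) (hM _) (abs_nonneg _) L.coe_nonneg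
  · filter_upwards [ae_restrict_of_ae (ae_abs_deriv_comp_le_metricDeriv hx hL hK)] with t ht
    rw [NNReal.smul_def, smul_eq_mul, norm_mul, Real.coe_toNNReal _ (metricDeriv_nonneg x θ t),
      Real.norm_eq_abs, Real.norm_eq_abs, mul_left_comm, ← mul_assoc, mul_comm]
    exact mul_le_mul_of_nonneg_right ht (abs_nonneg _) |>.trans_eq (by ring)

theorem isCurrent_curveFunctional {x : ℕ → X} (hx : DenseRange x) {θ : ℝ → X}
    (hθ : ∃ L : ℝ≥0, LipschitzWith L θ) : IsCurrent (curveFunctional θ hθ) where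
  finite_mass := ⟨curveMeasure x θ, isFiniteMeasure_curveMeasure x hθ.choose_spec,
    massBound_curveFunctional hx hθ⟩
  continuity := curveFunctional_continuity θ hθ
  locality := curveFunctional_locality θ hθ

theorem curveMeasure_compl_image (x : ℕ → X) {θ : ℝ → X} (hθ : Continuous θ) :
    curveMeasure x θ (θ '' Set.Icc 0 1)ᶜ = 0 := by
  have hm : MeasurableSet (θ '' Set.Icc (0 : ℝ) 1) := (isCompact_Icc.image hθ).measurableSet
  rw [curveMeasure, Measure.map_apply hθ.measurable hm.compl]
  refine withDensity_absolutelyContinuous _ _ ?_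
  rw [Measure.restrict_apply (hθ.measurable hm.compl)]
  convert measure_empty (μ := (volume : Measure ℝ))
  ext t
  simp only [Set.mem_inter_iff, Set.mem_preimage, Set.mem_compl_iff, Set.mem_empty_iff_false,
    iff_false, not_and]
  exact fun h ht => h ⟨t, Set.Ioc_subset_Icc_self ht, rfl⟩

theorem isCountablyRectifiableSet_image_Icc {θ : ℝ → X} {L : ℝ≥0} (hL : LipschitzWith L θ) :
    IsCountablyRectifiableSet (θ '' Set.Icc 0 1) :=
  ⟨fun _ => θ '' Set.Icc 0 1, fun _ => ⟨Set.Icc 0 1, fun t => θ t, L, Metric.isBounded_Icc 0 1,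
    fun s t => hL s t, by rw [Set.image_eq_range]⟩, (Set.iUnion_const _).symm⟩

/-- A set of parameters whose image is `μH[1]`-null and at which `θ` expands small distances by a
fixed factor is Lebesgue null. -/
theorem volume_eq_zero_of_expanding {θ : ℝ → X} {E : Set ℝ} (hE : μH[1] (θ '' E) = 0) {r : ℝ}
    (hr : 0 < r) {K : ℝ≥0}
    (h : ∀ s ∈ E, ∀ t ∈ E, dist s t < r → dist s t ≤ K * dist (θ s) (θ t)) :
    volume E = 0 := by
  -- On a window of length r the local expansion becomes an antilipschitz bound, so the
  -- `μH[1]`-measure of the piece is controlled by that of its image; on ℝ, `μH[1]` is Lebesgue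
  -- measure.
  have hpiece : ∀ k : ℤ, volume (E ∩ Set.Ico (k * r) ((k + 1) * r)) = 0 := by
    intro k
    set E' := E ∩ Set.Ico (k * r) ((k + 1) * r)
    have hanti : AntilipschitzWith K (fun t : E' => θ t) := by
      refine AntilipschitzWith.of_le_mul_dist fun s t => h _ s.2.1 _ t.2.1 ?_
      have hs := s.2.2
      have ht := t.2.2
      rw [Real.dist_eq, abs_lt]
      constructor <;> nlinarith [hs.1, hs.2, ht.1, ht.2]
    have h1 := hanti.le_hausdorffMeasure_image (d := 1) zero_le_one Set.univ
    have h2 : μH[1] ((fun t : E' => θ t) '' Set.univ) = 0 := by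
      refine measure_mono_null ?_ hE
      rintro _ ⟨t, -, rfl⟩
      exact ⟨t, t.2.1, rfl⟩
    rw [h2, mul_zero] at h1
    have h3 := (isometry_subtype_coe (s := E')).hausdorffMeasure_image (Or.inl (zero_le_one (α := ℝ)))
      Set.univ
    rw [nonpos_iff_eq_zero.1 h1, Set.image_univ, Subtype.range_coe, hausdorffMeasure_real] at h3
    exact h3
  refine measure_mono_null (fun t ht => ?_) (measure_iUnion_null hpiece)
  refine Set.mem_iUnion.2 ⟨⌊t / r⌋, ht, ?_, ?_⟩
  · exact (le_div_iff₀ hr).1 (Int.floor_le _)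
  · exact (div_lt_iff₀ hr).1 (Int.lt_floor_add_one _)

/-- If the metric derivative is nonzero at t, some distance function has nonzero derivative there,
so θ expands distances near t. Sorting such t by the index n and a quantitative constant k gives
countably many sets on which θ expands uniformly, each null because its image lies in A. -/
theorem ae_metricDeriv_eq_zero_of_mem {x : ℕ → X} {θ : ℝ → X} {A : Set X}
    (hA : μH[1] A = 0) : ∀ᵐ t, θ t ∈ A → metricDeriv x θ t = 0 := by
  let E : ℕ → ℕ → Set ℝ := fun n k => {t | θ t ∈ A ∧ ∀ s, dist s t < 1 / (k + 1 : ℝ) →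
    dist s t ≤ (k + 1 : ℝ≥0) * dist (dist (x n) (θ s)) (dist (x n) (θ t))}
  have hE : ∀ n k, volume (E n k) = 0 := by
    intro n k
    refine volume_eq_zero_of_expanding (θ := θ) (measure_mono_null ?_ hA)
      (r := 1 / (k + 1 : ℝ)) (by positivity) (K := k + 1) ?_
    · rintro _ ⟨t, ht, rfl⟩
      exact ht.1
    · intro s _ t ht hst
      refine (ht.2 s hst).trans ?_
      gcongr
      exact dist_dist_dist_le_right _ _ _
  have hnull := measure_iUnion_null fun n => measure_iUnion_null (hE n)
  rw [← compl_mem_ae_iff] at hnull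
  filter_upwards [hnull] with t ht hA
  have hz : ∀ n, deriv (fun s => dist (x n) (θ s)) t = 0 := by
    intro n
    by_contra hne
    have hd := (differentiableAt_of_deriv_ne_zero hne).hasDerivAt
    -- A nonzero derivative makes s − t big-O of the increment of the distance function.
    obtain ⟨C, hC⟩ := ((hd.isTheta_sub hne).isBigO_symm.comp_tendsto prod_pure.ge).bound
    obtain ⟨δ, hδ, hball⟩ := Metric.eventually_nhds_iff.1 (eventually_map.1 hC)
    obtain ⟨k₁, hk₁⟩ := exists_nat_ge C
    obtain ⟨k₂, hk₂⟩ := exists_nat_one_div_lt hδ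
    refine ht (Set.mem_iUnion.2 ⟨n, Set.mem_iUnion.2 ⟨max k₁ k₂, hA, fun s hs => ?_⟩⟩)
    have hlt : dist s t < δ := hs.trans ((one_div_le_one_div_of_le (by positivity)
      (by gcongr; exact le_max_right _ _)).trans_lt hk₂)
    refine (hball hlt).trans ?_
    rw [Real.dist_eq]
    refine mul_le_mul_of_nonneg_right ?_ (abs_nonneg _)
    push_cast
    linarith [le_max_left (k₁ : ℝ) k₂]
  simp [metricDeriv, hz]

theorem curveMeasure_absolutelyContinuous (x : ℕ → X) {θ : ℝ → X} (hθ : Continuous θ) :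
    curveMeasure x θ ≪ μH[1] := by
  refine Measure.AbsolutelyContinuous.mk fun A hA h0 => ?_
  rw [curveMeasure, Measure.map_apply hθ.measurable hA, withDensity_apply _ (hθ.measurable hA)]
  rw [lintegral_eq_zero_iff (measurable_metricDeriv x θ).real_toNNReal.coe_nnreal_ennreal]
  filter_upwards [ae_restrict_mem (hθ.measurable hA),
    ae_restrict_of_ae (ae_restrict_of_ae (ae_metricDeriv_eq_zero_of_mem (x := x) (θ := θ) h0))] with t h1 h2
  simp [h2 h1]

end CurveMeasures

/-! ### Rectifiability is stable under scaling and mass-summable series. -/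

section RectifiableSums

variable {X : Type*} [MetricSpace X] [MeasurableSpace X] [BorelSpace X]

/-- `R` is a current and `μ` is a mass bound for it witnessing that it is rectifiable. -/
structure IsRectifiableWith (R : Functional X) (μ : Measure X) : Prop where
  isCurrent : IsCurrent R
  isFinite : IsFiniteMeasure μ
  massBound : MassBound R μ
  concentrated : ∃ S : Set X, IsCountablyRectifiableSet S ∧ μ Sᶜ = 0
  absolutelyContinuous : μ ≪ μH[1]

/-- This direction suffices for concentration, absolute continuity and upper mass bounds: any
explicit bounding measure dominates ‖T‖. -/
theorem massMeasure_le {T : Functional X} {μ : Measure X} (hμ : IsFiniteMeasure μ)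
    (h : MassBound T μ) : massMeasure T ≤ μ :=
  sInf_le ⟨hμ, h⟩

theorem IsRectifiableWith.isRectifiableCurrent {R : Functional X} {μ : Measure X}
    (h : IsRectifiableWith R μ) : IsRectifiableCurrent R where
  isCurrent := h.isCurrent
  concentrated := by
    obtain ⟨S, hS, hμ⟩ := h.concentrated
    exact ⟨S, hS, nonpos_iff_eq_zero.1
      ((massMeasure_le h.isFinite h.massBound _).trans_eq hμ)⟩
  absolutelyContinuous :=
    (Measure.absolutelyContinuous_of_le (massMeasure_le h.isFinite h.massBound)).trans
      h.absolutelyContinuous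

theorem isRectifiableWith_curve {x : ℕ → X} (hx : DenseRange x) {θ : ℝ → X}
    (hθ : ∃ L : ℝ≥0, LipschitzWith L θ) :
    IsRectifiableWith (curveFunctional θ hθ) (curveMeasure x θ) where
  isCurrent := isCurrent_curveFunctional hx hθ
  isFinite := isFiniteMeasure_curveMeasure x hθ.choose_spec
  massBound := massBound_curveFunctional hx hθ
  concentrated := ⟨_, isCountablyRectifiableSet_image_Icc hθ.choose_spec,
    curveMeasure_compl_image x hθ.choose_spec.continuous⟩
  absolutelyContinuous := curveMeasure_absolutelyContinuous x hθ.choose_spec.continuous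

theorem isRectifiableSet_empty : IsRectifiableSet (∅ : Set X) :=
  ⟨∅, fun t => t.2.elim, 0, Bornology.isBounded_empty, fun t => t.2.elim, by simp⟩

theorem IsCountablyRectifiableSet.iUnion {ι : Type*} [Countable ι] {S : ι → Set X}
    (hS : ∀ i, IsCountablyRectifiableSet (S i)) : IsCountablyRectifiableSet (⋃ i, S i) := by
  choose E hE hSE using hS
  -- `Option` adds an index for the empty set, so that an enumeration by ℕ exists even when `ι` is
  -- empty.
  obtain ⟨e, he⟩ := exists_surjective_nat (Option (ι × ℕ))
  refine ⟨fun n => (e n).elim ∅ fun p => E p.1 p.2, fun n => ?_, ?_⟩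
  · cases h : e n with
    | none => simpa [h] using isRectifiableSet_empty
    | some p => simpa [h] using hE p.1 p.2
  · ext y
    simp only [hSE, Set.mem_iUnion]
    constructor
    · rintro ⟨i, k, hy⟩
      obtain ⟨n, hn⟩ := he (some (i, k))
      exact ⟨n, by simpa [hn] using hy⟩
    · rintro ⟨n, hy⟩
      cases h : e n with
      | none => simp [h] at hy
      | some p => exact ⟨p.1, p.2, by simpa [h] using hy⟩

theorem MassBound.smul {T : Functional X} {μ : Measure X} (h : MassBound T μ) (a : ℝ) :
    MassBound (a • T) (‖a‖ₑ • μ) := by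
  intro f π K hK
  rw [integral_smul_measure, LinearMap.smul_apply, LinearMap.smul_apply, smul_eq_mul, abs_mul,
    smul_eq_mul, toReal_enorm, Real.norm_eq_abs, mul_left_comm]
  exact mul_le_mul_of_nonneg_left (h f π K hK) (abs_nonneg a)

theorem isFiniteMeasure_enorm_smul {μ : Measure X} (hμ : IsFiniteMeasure μ) (a : ℝ) :
    IsFiniteMeasure (‖a‖ₑ • μ) :=
  ⟨by simpa using ENNReal.mul_lt_top enorm_lt_top hμ.1⟩

theorem IsCurrent.smul {T : Functional X} (hT : IsCurrent T) (a : ℝ) : IsCurrent (a • T) where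
  finite_mass := by
    obtain ⟨μ, hμ, h⟩ := hT.finite_mass
    exact ⟨_, isFiniteMeasure_enorm_smul hμ a, h.smul a⟩
  continuity f π π' K hK hlim := (hT.continuity f π π' K hK hlim).const_mul a
  locality f π U b hU hf hπ := by
    rw [LinearMap.smul_apply, LinearMap.smul_apply, hT.locality f π U b hU hf hπ, smul_zero]

theorem IsRectifiableWith.smul {R : Functional X} {μ : Measure X} (h : IsRectifiableWith R μ)
    (a : ℝ) : IsRectifiableWith (a • R) (‖a‖ₑ • μ) where
  isCurrent := h.isCurrent.smul a
  isFinite := isFiniteMeasure_enorm_smul h.isFinite a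
  massBound := h.massBound.smul a
  concentrated := by
    obtain ⟨S, hS, hμ⟩ := h.concentrated
    exact ⟨S, hS, by simp [hμ]⟩
  absolutelyContinuous := h.absolutelyContinuous.smul_left _

theorem integrable_abs_lipB (f : LipB X) (μ : Measure X) [IsFiniteMeasure μ] :
    Integrable (fun x => |(f : X → ℝ) x|) μ := by
  obtain ⟨F, hF⟩ := f.2.1
  obtain ⟨M, hM⟩ := f.2.2
  exact Integrable.of_bound hF.continuous.abs.aestronglyMeasurable M
    (ae_of_all _ fun x => by simpa using hM x)

theorem MassBound.add {T T' : Functional X} {μ μ' : Measure X} [IsFiniteMeasure μ]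
    [IsFiniteMeasure μ'] (h : MassBound T μ) (h' : MassBound T' μ') :
    MassBound (T + T') (μ + μ') := by
  intro f π K hK
  rw [integral_add_measure (integrable_abs_lipB f μ) (integrable_abs_lipB f μ'), mul_add]
  exact (abs_add_le _ _).trans (add_le_add (h f π K hK) (h' f π K hK))

theorem IsCurrent.add {T T' : Functional X} (hT : IsCurrent T) (hT' : IsCurrent T') :
    IsCurrent (T + T') where
  finite_mass := by
    obtain ⟨μ, hμ, h⟩ := hT.finite_mass
    obtain ⟨μ', hμ', h'⟩ := hT'.finite_mass
    exact ⟨μ + μ', inferInstance, h.add h'⟩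
  continuity f π π' K hK hlim :=
    (hT.continuity f π π' K hK hlim).add (hT'.continuity f π π' K hK hlim)
  locality f π U b hU hf hπ := by
    rw [LinearMap.add_apply, LinearMap.add_apply, hT.locality f π U b hU hf hπ,
      hT'.locality f π U b hU hf hπ, add_zero]

/-- A countable sum of rectifiable currents with summable masses is rectifiable. -/
theorem exists_hasSum_isRectifiableWith {ι : Type*} [Countable ι] {R : ι → Functional X}
    {μ : ι → Measure X} (h : ∀ i, IsRectifiableWith (R i) (μ i))
    (hsum : ∑' i, μ i Set.univ ≠ ∞) :
    ∃ S : Functional X, IsRectifiableWith S (Measure.sum μ) ∧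
      ∀ f π, HasSum (fun i => R i f π) (S f π) := by
  have hfin : ∀ i, IsFiniteMeasure (μ i) := fun i => (h i).isFinite
  have hfin' : IsFiniteMeasure (Measure.sum μ) :=
    ⟨by rw [Measure.sum_apply _ .univ]; exact hsum.lt_top⟩
  have hmass : Summable fun i => (μ i Set.univ).toReal := ENNReal.summable_toReal hsum
  -- This domination depends on π only through K, so a single summable majorant serves the whole
  -- sequence in the continuity axiom.
  have hbound : ∀ (f : LipB X) (M : ℝ), (∀ x, |(f : X → ℝ) x| ≤ M) → ∀ (π : Lip X) (K : ℝ≥0),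
      LipschitzWith K (π : X → ℝ) → ∀ i, |R i f π| ≤ K * (M * (μ i Set.univ).toReal) := by
    intro f M hM π K hK i
    refine ((h i).massBound f π K hK).trans (mul_le_mul_of_nonneg_left ?_ K.coe_nonneg)
    refine (integral_mono (integrable_abs_lipB f _) (integrable_const M) hM).trans_eq ?_
    simp [Measure.real, mul_comm]
  have hs : ∀ f π, Summable fun i => R i f π := by
    intro f π
    obtain ⟨M, hM⟩ := f.2.2
    obtain ⟨K, hK⟩ := π.2
    exact Summable.of_norm_bounded ((hmass.mul_left M).mul_left (K : ℝ)) (hbound f M hM π K hK)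
  let S : Functional X := LinearMap.mk₂ ℝ (fun f π => ∑' i, R i f π)
    (fun f g π => by simpa using (hs f π).tsum_add (hs g π))
    (fun a f π => by simpa using tsum_mul_left)
    (fun f π π' => by simpa using (hs f π).tsum_add (hs f π'))
    (fun a f π => by simpa using tsum_mul_left)
  have hSB : MassBound S (Measure.sum μ) := by
    intro f π K hK
    exact tsum_of_norm_bounded (f := fun i => R i f π)
      ((hasSum_integral_measure (integrable_abs_lipB f (Measure.sum μ))).mul_left (K : ℝ))
      fun i => (h i).massBound f π K hK
  refine ⟨S, ⟨⟨⟨_, hfin', hSB⟩, ?_, ?_⟩, hfin', hSB, ?_, ?_⟩, fun f π => (hs f π).hasSum⟩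
  · intro f π π' K hK hlim
    obtain ⟨M, hM⟩ := f.2.2
    exact tendsto_tsum_of_dominated_convergence ((hmass.mul_left M).mul_left (K : ℝ))
      (fun i => (h i).isCurrent.continuity f π π' K hK hlim)
      (Eventually.of_forall fun j i => hbound f M hM (π j) K (hK j) i)
  · intro f π U b hU hf hπ
    change ∑' i, R i f π = 0
    simp [fun i => (h i).isCurrent.locality f π U b hU hf hπ]
  · choose E hE hE0 using fun i => (h i).concentrated
    refine ⟨⋃ i, E i, IsCountablyRectifiableSet.iUnion hE, ?_⟩
    rw [Measure.sum_apply_eq_zero]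
    exact fun i => measure_mono_null (Set.compl_subset_compl.2 (Set.subset_iUnion E i)) (hE0 i)
  · exact Measure.absolutelyContinuous_sum_left fun i => (h i).absolutelyContinuous

end RectifiableSums

/-! ### Approximating functionals on Lipschitz functions by difference quotients. -/

section LipschitzFree

variable {X : Type*} [MetricSpace X]

/-- The least Lipschitz constant of a Lipschitz function. -/
def lipConst (f : X → ℝ) : ℝ := ⨆ p : X × X, |f p.1 - f p.2| / dist p.1 p.2

theorem div_dist_le {f : X → ℝ} {K : ℝ≥0} (hf : LipschitzWith K f) (x y : X) :
    |f x - f y| / dist x y ≤ K :=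
  div_le_of_le_mul₀ dist_nonneg K.coe_nonneg (hf.dist_le_mul x y)

theorem lipConst_le {f : X → ℝ} {K : ℝ≥0} (hf : LipschitzWith K f) : lipConst f ≤ K :=
  Real.iSup_le (fun p => div_dist_le hf p.1 p.2) K.coe_nonneg

theorem lipConst_nonneg (f : X → ℝ) : 0 ≤ lipConst f :=
  Real.iSup_nonneg fun _ => by positivity

theorem div_dist_le_lipConst (f : Lip X) (x y : X) :
    |(f : X → ℝ) x - (f : X → ℝ) y| / dist x y ≤ lipConst (f : X → ℝ) := by
  obtain ⟨K, hK⟩ := f.2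
  exact le_ciSup (f := fun p : X × X => |(f : X → ℝ) p.1 - (f : X → ℝ) p.2| / dist p.1 p.2)
    ⟨K, by rintro _ ⟨p, rfl⟩; exact div_dist_le hK p.1 p.2⟩ (x, y)

theorem lipschitzWith_lipConst (f : Lip X) :
    LipschitzWith (lipConst (f : X → ℝ)).toNNReal (f : X → ℝ) := by
  refine LipschitzWith.of_dist_le_mul fun x y => ?_
  rw [Real.coe_toNNReal _ (lipConst_nonneg _)]
  rcases eq_or_ne x y with rfl | h
  · simp
  · exact (div_le_iff₀ (dist_pos.2 h)).1 (div_dist_le_lipConst f x y)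

theorem lipConst_add_le (f g : Lip X) :
    lipConst ((f + g : Lip X) : X → ℝ) ≤ lipConst (f : X → ℝ) + lipConst (g : X → ℝ) :=
  (lipConst_le ((lipschitzWith_lipConst f).add (lipschitzWith_lipConst g))).trans_eq <| by
    rw [NNReal.coe_add, Real.coe_toNNReal _ (lipConst_nonneg _),
      Real.coe_toNNReal _ (lipConst_nonneg _)]

theorem lipConst_smul (c : ℝ) (f : Lip X) :
    lipConst ((c • f : Lip X) : X → ℝ) = |c| * lipConst (f : X → ℝ) := by
  unfold lipConst
  rw [Real.mul_iSup_of_nonneg (abs_nonneg c)]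
  simp [← mul_sub, abs_mul, mul_div_assoc]

theorem lipConst_zero : lipConst ((0 : Lip X) : X → ℝ) = 0 := by
  simp [lipConst]

/-- `|φ(f)| ≤ A Lip(f)` for all Lipschitz functions `f`. -/
def LipBound (φ : Lip X →ₗ[ℝ] ℝ) (A : ℝ) : Prop :=
  ∀ (f : Lip X) (K : ℝ≥0), LipschitzWith K (f : X → ℝ) → |φ f| ≤ A * K

/-- Continuity along pointwise convergent sequences with bounded Lipschitz constants. -/
def LipContinuous (φ : Lip X →ₗ[ℝ] ℝ) : Prop :=
  ∀ (π : ℕ → Lip X) (π' : Lip X) (K : ℝ≥0), (∀ j, LipschitzWith K (π j : X → ℝ)) →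
    (∀ x, Tendsto (fun j => (π j : X → ℝ) x) atTop (𝓝 ((π' : X → ℝ) x))) →
    Tendsto (fun j => φ (π j)) atTop (𝓝 (φ π'))

/-- Otherwise there are 1-Lipschitz f_n vanishing at the first n points of the dense sequence with
|φ(f_n)| > δ; they tend pointwise to 0, contradicting continuity. -/
theorem LipContinuous.exists_finite_determination {φ : Lip X →ₗ[ℝ] ℝ} (hφ : LipContinuous φ)
    {x : ℕ → X} (hx : DenseRange x) {δ : ℝ} (hδ : 0 < δ) :
    ∃ n : ℕ, ∀ f : Lip X, LipschitzWith 1 (f : X → ℝ) →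
      (∀ i : Fin n, (f : X → ℝ) (x i) = 0) → |φ f| ≤ δ := by
  by_contra! hcon
  choose f hf1 hf0 hfδ using hcon
  have hlim := hφ f 0 1 hf1 fun y => by
    rw [Metric.tendsto_atTop]
    intro ε hε
    obtain ⟨k, hk⟩ := hx.exists_dist_lt y hε
    refine ⟨k + 1, fun n hn => ?_⟩
    have h0 := hf0 n ⟨k, hn⟩
    have h1 := (hf1 n).dist_le_mul y (x k)
    simp only at h0
    rw [h0, NNReal.coe_one, one_mul] at h1
    exact h1.trans_lt hk
  rw [map_zero, Metric.tendsto_atTop] at hlim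
  obtain ⟨N, hN⟩ := hlim δ hδ
  have := hN N le_rfl
  rw [Real.dist_eq, sub_zero] at this
  exact (hfδ N).not_gt this

/-- Homogeneity; K = 0 cannot be rescaled and is settled by the a priori bound A. -/
theorem LipBound.le_of_vanishing {φ : Lip X →ₗ[ℝ] ℝ} {A : ℝ} (hA : LipBound φ A)
    {n : ℕ} {p : Fin n → X} {δ : ℝ}
    (h : ∀ f : Lip X, LipschitzWith 1 (f : X → ℝ) → (∀ i, (f : X → ℝ) (p i) = 0) → |φ f| ≤ δ)
    {f : Lip X} {K : ℝ≥0} (hf : LipschitzWith K (f : X → ℝ)) (h0 : ∀ i, (f : X → ℝ) (p i) = 0) :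
    |φ f| ≤ δ * K := by
  rcases eq_or_ne K 0 with rfl | hK
  · simpa using hA f 0 hf
  · have hK' : (0 : ℝ) < K := by positivity
    have h1 := h ((K : ℝ)⁻¹ • f) (LipschitzWith.of_dist_le_mul fun x y => ?_) fun i => by simp [h0 i]
    · rw [map_smul, smul_eq_mul, abs_mul, abs_inv, abs_of_pos hK', inv_mul_le_iff₀ hK'] at h1
      rwa [mul_comm]
    · have h2 := hf.dist_le_mul x y
      rw [Real.dist_eq] at h2
      simp only [SetLike.val_smul, Pi.smul_apply, smul_eq_mul, Real.dist_eq, ← mul_sub, abs_mul,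
        abs_inv, abs_of_pos hK', NNReal.coe_one, one_mul]
      rwa [inv_mul_le_iff₀ hK']

/-- The difference quotients of `f` between finitely many points. -/
def differenceQuotient {n : ℕ} (p : Fin n → X) : Lip X →ₗ[ℝ] (Fin n × Fin n → ℝ) where
  toFun f := fun k => ((f : X → ℝ) (p k.1) - (f : X → ℝ) (p k.2)) / dist (p k.1) (p k.2)
  map_add' f g := by
    ext k
    simp only [Submodule.coe_add, Pi.add_apply]
    ring
  map_smul' c f := by
    ext k
    simp only [SetLike.val_smul, Pi.smul_apply, smul_eq_mul, RingHom.id_apply]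
    ring

theorem abs_differenceQuotient {n : ℕ} (p : Fin n → X) (f : Lip X) (k : Fin n × Fin n) :
    |differenceQuotient p f k| =
      |(f : X → ℝ) (p k.1) - (f : X → ℝ) (p k.2)| / dist (p k.1) (p k.2) := by
  rw [show differenceQuotient p f k =
    ((f : X → ℝ) (p k.1) - (f : X → ℝ) (p k.2)) / dist (p k.1) (p k.2) from rfl, abs_div,
    abs_of_nonneg (dist_nonneg (x := p k.1))]

theorem norm_differenceQuotient_le {n : ℕ} (p : Fin n → X) (f : Lip X) :
    ‖differenceQuotient p f‖ ≤ lipConst (f : X → ℝ) := by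
  refine (pi_norm_le_iff_of_nonneg (lipConst_nonneg _)).2 fun k => ?_
  rw [Real.norm_eq_abs, abs_differenceQuotient]
  exact div_dist_le_lipConst f _ _

/-- Extend f from the finite set to all of X with constant ‖Df‖ ≤ Lip(f). The extension costs A‖Df‖;
its difference from f vanishes on the set and has Lipschitz constant at most 2 Lip(f). -/
theorem LipBound.le_norm_differenceQuotient_add {φ : Lip X →ₗ[ℝ] ℝ} {A : ℝ} (hA : LipBound φ A)
    {n : ℕ} {p : Fin n → X} {δ : ℝ} (hδ : 0 ≤ δ)
    (h : ∀ f : Lip X, LipschitzWith 1 (f : X → ℝ) → (∀ i, (f : X → ℝ) (p i) = 0) → |φ f| ≤ δ)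
    (f : Lip X) :
    φ f ≤ A * ‖differenceQuotient p f‖ + 2 * δ * lipConst (f : X → ℝ) := by
  have hon : LipschitzOnWith ‖differenceQuotient p f‖₊ (f : X → ℝ) (Set.range p) := by
    refine LipschitzOnWith.of_dist_le_mul ?_
    rintro _ ⟨i, rfl⟩ _ ⟨j, rfl⟩
    rcases eq_or_ne (p i) (p j) with hij | hij
    · simp [hij]
    · have h1 := norm_le_pi_norm (differenceQuotient p f) (i, j)
      rw [Real.norm_eq_abs, abs_differenceQuotient] at h1
      exact (div_le_iff₀ (dist_pos.2 hij)).1 h1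
  obtain ⟨g, hg, hfg⟩ := hon.extend_real
  let g' : Lip X := ⟨g, _, hg⟩
  have h1 : |φ g'| ≤ A * ‖differenceQuotient p f‖ := hA g' _ hg
  have h2 := hA.le_of_vanishing h (f := f - g') ((lipschitzWith_lipConst f).sub hg) fun i => by
    simpa [g', sub_eq_zero] using hfg ⟨i, rfl⟩
  have h3 : (((lipConst (f : X → ℝ)).toNNReal + ‖differenceQuotient p f‖₊ : ℝ≥0) : ℝ)
      ≤ 2 * lipConst (f : X → ℝ) := by
    have := norm_differenceQuotient_le p f
    rw [NNReal.coe_add, Real.coe_toNNReal _ (lipConst_nonneg _), coe_nnnorm]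
    linarith
  have h4 := mul_le_mul_of_nonneg_left h3 hδ
  rw [map_sub] at h2
  linarith [le_abs_self (φ g'), le_abs_self (φ f - φ g')]

/-- A weakly continuous functional on Lipschitz functions is, up to a small Lipschitz bound, a
finite combination of difference quotients with the right total weight. -/
theorem LipBound.exists_approx {φ : Lip X →ₗ[ℝ] ℝ} {A : ℝ} (hA : LipBound φ A) (hA0 : 0 ≤ A)
    (hφ : LipContinuous φ) {x : ℕ → X} (hx : DenseRange x) {δ : ℝ} (hδ : 0 < δ) :
    ∃ (n : ℕ) (b : Fin n × Fin n → ℝ), ∑ k, |b k| ≤ A ∧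
      ∀ (f : Lip X) (K : ℝ≥0), LipschitzWith K (f : X → ℝ) →
        |φ f - ∑ k, b k * differenceQuotient (fun i : Fin n => x i) f k| ≤ δ * K := by
  obtain ⟨n, hn⟩ := hφ.exists_finite_determination hx (half_pos hδ)
  set p : Fin n → X := fun i => x i
  set D := differenceQuotient p
  have hle := hA.le_norm_differenceQuotient_add (half_pos hδ).le hn
  -- On the graph of `D`, φ is dominated by `N`. Because `N` is a sum of a term in each variable, an
  -- extension `G` below `N` splits φ(f) into G(f, 0), of size δ Lip(f), and G(0, Df), a combination
  -- of difference quotients.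
  let N : Lip X × (Fin n × Fin n → ℝ) → ℝ := fun q => A * ‖q.2‖ + δ * lipConst (q.1 : X → ℝ)
  let F : (Lip X × (Fin n × Fin n → ℝ)) →ₗ.[ℝ] ℝ :=
    ⟨D.graph, φ.comp ((LinearMap.fst ℝ _ _).comp D.graph.subtype)⟩
  obtain ⟨G, hG, hGN⟩ := exists_extension_of_le_sublinear F N
    (fun c hc q => by
      simp only [N, Prod.smul_fst, Prod.smul_snd, norm_smul, lipConst_smul, Real.norm_eq_abs,
        abs_of_pos hc]
      ring)
    (fun q r => by
      have h1 := mul_le_mul_of_nonneg_left (norm_add_le q.2 r.2) hA0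
      have h2 := mul_le_mul_of_nonneg_left (lipConst_add_le q.1 r.1) hδ.le
      simp only [N, Prod.fst_add, Prod.snd_add]
      linarith)
    (by
      rintro ⟨⟨f, g⟩, hfg⟩
      have hg : g = D f := LinearMap.mem_graph_iff D _ |>.1 hfg
      subst hg
      refine (hle f).trans_eq ?_
      simp only [N]
      ring)
  let b : Fin n × Fin n → ℝ := fun k => G (0, Pi.single k 1)
  have hb : ∀ g : Fin n × Fin n → ℝ, G (0, g) = ∑ k, b k * g k := by
    intro g
    have := LinearMap.pi_apply_eq_sum_univ (G.comp (LinearMap.inr ℝ _ _)) g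
    simp only [LinearMap.comp_apply, LinearMap.inr_apply, smul_eq_mul] at this
    rw [this]
    refine Finset.sum_congr rfl fun k _ => ?_
    rw [mul_comm]
    congr 3
    ext j
    simp [Pi.single_apply, eq_comm]
  have hfirst : ∀ f : Lip X, G (f, 0) ≤ δ * lipConst (f : X → ℝ) := fun f => by
    simpa [N] using hGN (f, 0)
  refine ⟨n, b, ?_, fun f K hf => ?_⟩
  -- Testing with the signs of `b`, a vector of sup norm at most 1, turns G(0, ·) ≤ A‖·‖ into the ℓ¹
  -- bound.
  · have h1 := hGN (0, fun k => SignType.sign (b k))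
    rw [hb] at h1
    simp only [N, lipConst_zero, mul_zero, add_zero, mul_comm (b _), sign_mul_self] at h1
    refine h1.trans (mul_le_of_le_one_right hA0 ?_)
    refine (pi_norm_le_iff_of_nonneg zero_le_one).2 fun k => ?_
    rcases SignType.sign (b k) with _ | _ | _ <;> simp
  · have h1 : φ f = G (f, 0) + G (0, D f) := by
      rw [← map_add, Prod.mk_add_mk, add_zero, zero_add]
      exact (hG ⟨(f, D f), LinearMap.mem_graph_iff D _ |>.2 rfl⟩).symm
    rw [h1, hb, add_sub_cancel_right]
    have h2 := hfirst f
    have h3 := hfirst (-f)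
    have h4 : G (-f, 0) = - G (f, 0) := by rw [← map_neg, Prod.neg_mk, neg_zero]
    have h5 : lipConst ((-f : Lip X) : X → ℝ) = lipConst (f : X → ℝ) := by
      simpa using lipConst_smul (-1) f
    rw [h4, h5] at h3
    have h6 := mul_le_mul_of_nonneg_left (lipConst_le hf) hδ.le
    exact abs_le.2 ⟨by linarith, by linarith⟩

end LipschitzFree

/-! ### Replacing difference quotients by curves and iterating. -/

section Filling

variable {X : Type*} [MetricSpace X]

/-- Freeze θ outside [0, 1] by projecting the parameter. Length involves only interior t and small h
> 0, so it is unchanged. -/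
theorem exists_lipschitzWith_curve {θ : ℝ → X} {K : ℝ≥0} (hθ : LipschitzOnWith K θ (Set.Icc 0 1)) :
    ∃ θ' : ℝ → X, (∃ L : ℝ≥0, LipschitzWith L θ') ∧ θ' 0 = θ 0 ∧ θ' 1 = θ 1 ∧
      curveLength θ' = curveLength θ := by
  have hproj : ∀ t ∈ Set.Icc (0 : ℝ) 1,
      θ (Set.projIcc (0 : ℝ) 1 zero_le_one t) = θ t := fun t ht => by
    rw [Set.projIcc_of_mem zero_le_one ht]
  refine ⟨fun t => θ (Set.projIcc (0 : ℝ) 1 zero_le_one t), ⟨K * 1,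
    hθ.to_restrict.comp (LipschitzWith.projIcc zero_le_one)⟩, hproj 0 (by simp), hproj 1 (by simp),
    setLIntegral_congr_fun measurableSet_Ioo fun t ht => limsup_congr ?_⟩
  filter_upwards [Ioo_mem_nhdsGT (sub_pos.2 ht.2)] with h hh
  rw [hproj t ⟨ht.1.le, ht.2.le⟩, hproj (t + h) ⟨by linarith [ht.1, hh.1], by linarith [hh.2]⟩]

theorem abs_sub_sum_le {m : ℕ} (p q : Fin (m + 1) → X) (x y : X) {f : X → ℝ} {K : ℝ≥0}
    (hf : LipschitzWith K f) :
    |f y - f x - ∑ i, (f (q i) - f (p i))| ≤ K * (dist x (p 0) + dist (q (Fin.last m)) y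
        + ∑ i : Fin m, dist (p i.succ) (q i.castSucc)) := by
  have h : f y - f x - ∑ i, (f (q i) - f (p i)) = (f (p 0) - f x) + (f y - f (q (Fin.last m)))
      + ∑ i : Fin m, (f (p i.succ) - f (q i.castSucc)) := by
    rw [Finset.sum_sub_distrib, Finset.sum_sub_distrib, Fin.sum_univ_castSucc (fun i => f (q i)),
      Fin.sum_univ_succ (fun i => f (p i))]
    ring
  have hd : ∀ a b, |f a - f b| ≤ K * dist a b := fun a b => hf.dist_le_mul a b
  rw [h, mul_add, mul_add, Finset.mul_sum]
  refine (abs_add_le _ _).trans (add_le_add ((abs_add_le _ _).trans (add_le_add ?_ ?_)) ?_)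
  · rw [dist_comm]
    exact hd _ _
  · rw [dist_comm]
    exact hd _ _
  · exact (Finset.abs_sum_le_sum_abs _ _).trans (Finset.sum_le_sum fun i _ => hd _ _)

variable [MeasurableSpace X] [BorelSpace X]

theorem IsCurrent.lipContinuous_oneB {T : Functional X} (hT : IsCurrent T) :
    LipContinuous (T (oneB X)) :=
  fun π π' K hK hlim => hT.continuity _ π π' K hK hlim

theorem LipContinuous.sub {φ ψ : Lip X →ₗ[ℝ] ℝ} (hφ : LipContinuous φ) (hψ : LipContinuous ψ) :
    LipContinuous (φ - ψ) :=
  fun π π' K hK hlim => (hφ π π' K hK hlim).sub (hψ π π' K hK hlim)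

/-- In a piecewise quasiconvex space, a weakly continuous functional is approximated by the
boundary of a finite combination of curves of controlled total length. -/
theorem PiecewiseQuasiconvex.exists_approx {c : ℝ} (hX : PiecewiseQuasiconvex X c) {x : ℕ → X}
    (hx : DenseRange x) {φ : Lip X →ₗ[ℝ] ℝ} (hφ : LipContinuous φ) {A : ℝ} (hA0 : 0 ≤ A)
    (hA : LipBound φ A) {δ : ℝ} (hδ : 0 < δ) :
    ∃ (R : Functional X) (μ : Measure X), IsRectifiableWith R μ ∧
      μ Set.univ ≤ ENNReal.ofReal (c * A) ∧ LipBound (φ - R (oneB X)) δ := by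
  obtain ⟨n, b, hbA, hb⟩ := hA.exists_approx hA0 hφ hx (half_pos hδ)
  set w : Fin n × Fin n → ℝ := fun k => b k / dist (x k.1) (x k.2) with hw
  have hW : 0 < ∑ k, |w k| + 1 := by positivity
  -- Each curve chain runs from `x k.2` to `x k.1`, matching the sign of the difference quotient.
  -- The tolerance makes the jumps, weighted by `w`, cost at most δ/2 in total; the 1 keeps the
  -- denominator positive.
  choose m p q θ hjump hθ hpq hlen using fun k : Fin n × Fin n =>
    hX.2 (x k.2) (x k.1) (δ / 2 / (∑ k, |w k| + 1)) (by positivity)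
  choose K hK using hθ
  choose θ' hθ' h0 h1 hlen' using fun k i => exists_lipschitzWith_curve (hK k i)
  have hrect := fun s : (k : Fin n × Fin n) × Fin (m k + 1) =>
    (isRectifiableWith_curve hx (hθ' s.1 s.2)).smul (w s.1)
  have hmass : ∑' s : (k : Fin n × Fin n) × Fin (m k + 1),
      (‖w s.1‖ₑ • curveMeasure x (θ' s.1 s.2)) Set.univ ≤ ENNReal.ofReal (c * A) := by
    have hc : 0 ≤ c := zero_le_one.trans hX.1
    rw [tsum_fintype, Fintype.sum_sigma]
    calc _ ≤ ∑ k, ‖w k‖ₑ * ENNReal.ofReal (c * dist (x k.2) (x k.1)) := by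
          refine Finset.sum_le_sum fun k _ => ?_
          simp only [Measure.smul_apply, smul_eq_mul]
          rw [← Finset.mul_sum]
          gcongr
          refine le_trans (Finset.sum_le_sum fun i _ => ?_) (hlen k)
          exact (curveMeasure_univ_le x (hθ' k i).choose_spec.continuous).trans_eq (hlen' k i)
      _ ≤ ∑ k, ENNReal.ofReal (c * |b k|) := by
          refine Finset.sum_le_sum fun k _ => ?_
          rw [Real.enorm_eq_ofReal_abs, ← ENNReal.ofReal_mul (abs_nonneg _)]
          refine ENNReal.ofReal_le_ofReal ?_
          rw [mul_left_comm, hw, abs_div, dist_comm (x k.2),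
            abs_of_nonneg (dist_nonneg (x := x k.1))]
          gcongr
          rcases eq_or_ne (dist (x k.1) (x k.2)) 0 with hd | hd
          · simp [hd]
          · exact (div_mul_cancel₀ _ hd).le
      _ = ENNReal.ofReal (c * ∑ k, |b k|) := by
          rw [Finset.mul_sum, ENNReal.ofReal_sum_of_nonneg fun k _ => by positivity]
      _ ≤ _ := by gcongr
  obtain ⟨S, hS, hsum⟩ := exists_hasSum_isRectifiableWith hrect
    (hmass.trans_lt ENNReal.ofReal_lt_top).ne
  refine ⟨S, _, hS, by rwa [Measure.sum_apply _ .univ], fun f L hL => ?_⟩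
  have hSf : S (oneB X) f =
      ∑ k, w k * ∑ i, ((f : X → ℝ) (q k i) - (f : X → ℝ) (p k i)) := by
    rw [← (hsum (oneB X) f).tsum_eq, tsum_fintype, Fintype.sum_sigma]
    refine Finset.sum_congr rfl fun k _ => ?_
    rw [Finset.mul_sum]
    refine Finset.sum_congr rfl fun i _ => ?_
    rw [LinearMap.smul_apply, LinearMap.smul_apply, curveFunctional_oneB, h0, h1,
      (hpq k i).1, (hpq k i).2, smul_eq_mul]
  have hdiff : (φ - S (oneB X)) f =
      (φ f - ∑ k, b k * differenceQuotient (fun i : Fin n => x i) f k) +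
      ∑ k, w k * ((f : X → ℝ) (x k.1) - (f : X → ℝ) (x k.2)
        - ∑ i, ((f : X → ℝ) (q k i) - (f : X → ℝ) (p k i))) := by
    have : ∀ k, b k * differenceQuotient (fun i : Fin n => x i) f k =
        w k * ((f : X → ℝ) (x k.1) - (f : X → ℝ) (x k.2)) := fun k =>
      (mul_div_assoc _ _ _).symm.trans (mul_div_right_comm _ _ _)
    rw [LinearMap.sub_apply, hSf]
    simp only [this, mul_sub, Finset.sum_sub_distrib]
    ring
  rw [hdiff]
  rw [show δ * (L : ℝ) = δ / 2 * L + δ / 2 * L by ring]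
  refine (abs_add_le _ _).trans (add_le_add (hb f L hL) ?_)
  calc _ ≤ ∑ k, |w k| * (L * (δ / 2 / (∑ k, |w k| + 1))) := by
        refine (Finset.abs_sum_le_sum_abs _ _).trans (Finset.sum_le_sum fun k _ => ?_)
        rw [abs_mul]
        refine mul_le_mul_of_nonneg_left ((abs_sub_sum_le (p k) (q k) _ _ hL).trans ?_)
          (abs_nonneg _)
        exact mul_le_mul_of_nonneg_left (hjump k).le L.coe_nonneg
    _ = (∑ k, |w k|) / (∑ k, |w k| + 1) * (δ / 2 * L) := by
        rw [← Finset.sum_mul]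
        ring
    _ ≤ δ / 2 * L := by
        refine mul_le_of_le_one_left (by positivity) ?_
        exact (div_le_one hW).2 (by linarith)

/-- In a piecewise quasiconvex space, a weakly continuous functional is the boundary of a
rectifiable current of controlled mass. -/
theorem PiecewiseQuasiconvex.exists_filling {c : ℝ} (hX : PiecewiseQuasiconvex X c) {x : ℕ → X}
    (hx : DenseRange x) {φ : Lip X →ₗ[ℝ] ℝ} (hφ : LipContinuous φ) {A : ℝ} (hA0 : 0 ≤ A)
    (hA : LipBound φ A) {ε : ℝ} (hε : 0 < ε) :
    ∃ (R : Functional X) (μ : Measure X), IsRectifiableWith R μ ∧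
      μ Set.univ ≤ ENNReal.ofReal (c * A) + ENNReal.ofReal ε ∧ R (oneB X) = φ := by
  have hc : 0 < c := zero_lt_one.trans_le hX.1
  -- Stage k corrects a remainder of Lipschitz bound a_k at mass cost c a_k. After the first term
  -- cA, the costs sum to exactly ε.
  let a : ℕ → ℝ := fun k => k.casesOn A fun j => ε / c / 2 / 2 ^ j
  have ha0 : ∀ k, 0 ≤ a k := by
    rintro (_ | j)
    · exact hA0
    · change 0 ≤ ε / c / 2 / 2 ^ j
      positivity
  let σ : ℕ → Type _ := fun k => {ψ : Lip X →ₗ[ℝ] ℝ // LipContinuous ψ ∧ LipBound ψ (a k)}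
  choose R μ hR hmass hnext using fun k (ψ : σ k) =>
    hX.exists_approx hx ψ.2.1 (ha0 k) ψ.2.2 (δ := a (k + 1))
      (by change 0 < ε / c / 2 / 2 ^ k; positivity)
  let s : ∀ k, σ k := fun k => Nat.rec ⟨φ, hφ, hA⟩ (fun k ψ => ⟨ψ.1 - R k ψ (oneB X),
    ψ.2.1.sub (hR k ψ).isCurrent.lipContinuous_oneB, hnext k ψ⟩) k
  have hs : ∀ k, (s (k + 1)).1 = (s k).1 - R k (s k) (oneB X) := fun k => rfl
  have htot : ∑' k, μ k (s k) Set.univ ≤ ENNReal.ofReal (c * A) + ENNReal.ofReal ε := by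
    refine (ENNReal.tsum_le_tsum fun k => hmass k (s k)).trans ?_
    rw [tsum_eq_zero_add' ENNReal.summable]
    refine add_le_add le_rfl (le_of_eq ?_)
    change ∑' k : ℕ, ENNReal.ofReal (c * (ε / c / 2 / 2 ^ k)) = _
    rw [← ENNReal.ofReal_tsum_of_nonneg (fun k => by positivity)
      ((summable_geometric_two' _).mul_left _), tsum_mul_left, tsum_geometric_two',
      mul_div_cancel₀ _ hc.ne']
  obtain ⟨S, hS, hsum⟩ := exists_hasSum_isRectifiableWith (fun k => hR k (s k))
    (htot.trans_lt (by simp)).ne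
  refine ⟨S, _, hS, by rwa [Measure.sum_apply _ .univ], LinearMap.ext fun f => ?_⟩
  -- Boundaries of the partial sums telescope, and the remainders vanish with a_N.
  have hpart : ∀ N, ∑ k ∈ Finset.range N, R k (s k) (oneB X) f = φ f - (s N).1 f := by
    intro N
    induction N with
    | zero => simp [s]
    | succ N ih =>
      rw [Finset.sum_range_succ, ih, hs, LinearMap.sub_apply]
      ring
  obtain ⟨K, hK⟩ := f.2
  have hzero : Tendsto (fun N => (s (N + 1)).1 f) atTop (𝓝 0) := by
    refine squeeze_zero_norm (fun N => (s (N + 1)).2.2 f K hK) ?_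
    have := ((summable_geometric_two' (ε / c)).tendsto_atTop_zero).mul_const (K : ℝ)
    rwa [zero_mul] at this
  have h1 := (tendsto_add_atTop_iff_nat 1).2 (hsum (oneB X) f).tendsto_sum_nat
  simp only [hpart] at h1
  have h2 := hzero.const_sub (φ f)
  rw [sub_zero] at h2
  exact tendsto_nhds_unique h1 h2

end Filling

/-! ### Bounding measures with total mass close to the mass of the current. -/

section MassMeasure

variable {X : Type*} [MetricSpace X]

/-- The product of two bounded Lipschitz functions. -/
def LipB.mul (f g : LipB X) : LipB X :=
  ⟨fun x => (f : X → ℝ) x * (g : X → ℝ) x, by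
    obtain ⟨⟨K, hK⟩, M, hM⟩ := f.2
    obtain ⟨⟨L, hL⟩, N, hN⟩ := g.2
    refine ⟨⟨M.toNNReal * L + N.toNNReal * K, LipschitzWith.of_dist_le_mul fun x y => ?_⟩, M * N,
      fun x => ?_⟩
    · have h1 : |(f : X → ℝ) x| ≤ M.toNNReal := (hM x).trans (Real.le_coe_toNNReal M)
      have h2 : |(g : X → ℝ) y| ≤ N.toNNReal := (hN y).trans (Real.le_coe_toNNReal N)
      have h3 := hL.dist_le_mul x y
      have h4 := hK.dist_le_mul x y
      rw [Real.dist_eq] at *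
      calc _ = |(f : X → ℝ) x * ((g : X → ℝ) x - (g : X → ℝ) y)
              + (g : X → ℝ) y * ((f : X → ℝ) x - (f : X → ℝ) y)| := by ring_nf
        _ ≤ M.toNNReal * (L * dist x y) + N.toNNReal * (K * dist x y) := by
          refine (abs_add_le _ _).trans ?_
          rw [abs_mul, abs_mul]
          gcongr
        _ = _ := by push_cast; ring
    · rw [abs_mul]
      exact mul_le_mul (hM x) (hN x) (abs_nonneg _) ((abs_nonneg _).trans (hM x))⟩

theorem LipB.mul_apply (f g : LipB X) (x : X) :
    (LipB.mul f g : X → ℝ) x = (f : X → ℝ) x * (g : X → ℝ) x := rfl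

variable [MeasurableSpace X] [BorelSpace X]

theorem measurable_lipB (f : LipB X) : Measurable (f : X → ℝ) := by
  obtain ⟨F, hF⟩ := f.2.1
  exact hF.continuous.measurable

theorem integrable_indicator_one {A : Set X} (hA : MeasurableSet A) (μ : Measure X)
    [IsFiniteMeasure μ] : Integrable (A.indicator (fun _ => (1 : ℝ))) μ :=
  (integrable_const _).indicator hA

theorem integrable_lipB (f : LipB X) (μ : Measure X) [IsFiniteMeasure μ] :
    Integrable (f : X → ℝ) μ :=
  (integrable_norm_iff (measurable_lipB f).aestronglyMeasurable).1 (integrable_abs_lipB f μ)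

/-- Approximate A from inside by a closed set, then use its thickened indicators, which are bounded
and Lipschitz. -/
theorem exists_lipB_integral_abs_sub_indicator_le {A : Set X} (hA : MeasurableSet A)
    (μ : Measure X) [IsFiniteMeasure μ] {δ : ℝ} (hδ : 0 < δ) :
    ∃ f : LipB X, ∫ x, |(f : X → ℝ) x - A.indicator (fun _ => (1 : ℝ)) x| ∂μ ≤ δ := by
  obtain ⟨F, hFA, hF, hlt⟩ := hA.exists_isClosed_sdiff_lt (measure_ne_top μ A)
    (ENNReal.ofReal_pos.2 (half_pos hδ)).ne'
  have hlim := tendsto_integral_thickenedIndicator_of_isClosed μ hF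
    (δs := fun n : ℕ => 1 / ((n : ℝ) + 1)) (fun n => by positivity)
    tendsto_one_div_add_atTop_nhds_zero_nat
  obtain ⟨n, hn⟩ := (hlim.eventually (gt_mem_nhds (lt_add_of_pos_right _ (half_pos hδ)))).exists
  have hpos : (0 : ℝ) < 1 / ((n : ℝ) + 1) := by positivity
  let f : LipB X := ⟨fun x => (thickenedIndicator hpos F x : ℝ),
    ⟨_, fun x y => lipschitzWith_thickenedIndicator hpos F x y⟩, 1, fun x => by
      rw [abs_of_nonneg (NNReal.coe_nonneg _)]
      exact_mod_cast thickenedIndicator_le_one hpos F x⟩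
  have hfF : ∀ x, F.indicator (fun _ => (1 : ℝ)) x ≤ (f : X → ℝ) x := fun x => by
    by_cases hx : x ∈ F
    · have h1 : (thickenedIndicator hpos F x : ℝ) = 1 := by
        exact_mod_cast thickenedIndicator_one hpos F hx
      rw [Set.indicator_of_mem hx]
      exact h1.ge
    · simp [f, hx]
  refine ⟨f, ?_⟩
  have hle : ∀ x, |(f : X → ℝ) x - A.indicator (fun _ => (1 : ℝ)) x| ≤
      ((f : X → ℝ) x - F.indicator (fun _ => (1 : ℝ)) x)
        + (A \ F).indicator (fun _ => (1 : ℝ)) x := by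
    intro x
    have h1 : A.indicator (fun _ => (1 : ℝ)) x =
        F.indicator (fun _ => (1 : ℝ)) x + (A \ F).indicator (fun _ => (1 : ℝ)) x := by
      by_cases hx : x ∈ F
      · simp [hx, hFA hx]
      · by_cases hx' : x ∈ A <;> simp [hx, hx']
    have h2 : 0 ≤ (A \ F).indicator (fun _ => (1 : ℝ)) x :=
      Set.indicator_nonneg (fun _ _ => zero_le_one) x
    have h3 := hfF x
    rw [h1, abs_le]
    constructor <;> linarith
  have hiF := integrable_indicator_one hF.measurableSet μ
  have hiD := integrable_indicator_one (hA.diff hF.measurableSet) μ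
  have hif := integrable_lipB f μ
  refine (integral_mono ((hif.sub (integrable_indicator_one hA μ)).abs)
    ((hif.sub hiF).add hiD) hle).trans ?_
  rw [integral_add' (hif.sub hiF) hiD, integral_sub' hif hiF,
    integral_indicator_const _ hF.measurableSet,
    integral_indicator_const _ (hA.diff hF.measurableSet), smul_eq_mul, smul_eq_mul, mul_one,
    mul_one]
  have h1 : ∫ x, (f : X → ℝ) x ∂μ < μ.real F + δ / 2 := hn
  have h2 : μ.real (A \ F) ≤ δ / 2 := ENNReal.toReal_le_of_le_ofReal (half_pos hδ).le hlt.le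
  linarith

theorem abs_integral_mul_le {f : X → ℝ} {M : ℝ} (hM : ∀ x, |f x| ≤ M) {g h : X → ℝ}
    {μ : Measure X} (hh : Integrable h μ) (hg : ∀ x, |g x| ≤ h x) :
    ∫ x, |f x * g x| ∂μ ≤ M * ∫ x, h x ∂μ := by
  rw [← integral_const_mul]
  refine integral_mono_of_nonneg (ae_of_all _ fun _ => abs_nonneg _) (hh.const_mul M)
    (ae_of_all _ fun x => ?_)
  simp only [abs_mul]
  exact mul_le_mul (hM x) (hg x) (abs_nonneg _) ((abs_nonneg _).trans (hM x))

/-- Mass bounds can be glued along a countable measurable partition. -/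
theorem MassBound.glue {T : Functional X} {μ : ℕ → Measure X} [∀ n, IsFiniteMeasure (μ n)]
    (h : ∀ n, MassBound T (μ n)) {A : ℕ → Set X} (hA : ∀ n, MeasurableSet (A n))
    (hdisj : Pairwise (Function.onFun Disjoint A)) (hcover : ⋃ n, A n = Set.univ)
    (hfin : IsFiniteMeasure (Measure.sum fun n => (μ n).restrict (A n))) :
    MassBound T (Measure.sum fun n => (μ n).restrict (A n)) := by
  intro f π K hK
  set I := ∫ x, |(f : X → ℝ) x| ∂(Measure.sum fun n => (μ n).restrict (A n))
  have hI : HasSum (fun n => ∫ x in A n, |(f : X → ℝ) x| ∂(μ n)) I :=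
    hasSum_integral_measure (integrable_abs_lipB f _)
  obtain ⟨M, hM0, hM⟩ := LipB.exists_abs_le f
  -- Split f into the parts f φ_n for n < N, with φ_n close to the indicator of A_n in L¹ of both
  -- μ_n and μ_0, and a remainder. The n-th part is charged to μ_n and the remainder to μ_0, for
  -- which the uncovered mass tends to 0.
  have hbound : ∀ N : ℕ, |T f π| ≤ K * (I + M * (1 / ((N : ℝ) + 1))
      + M * ((μ 0).real Set.univ - ∑ n ∈ Finset.range N, (μ 0).real (A n)
        + 1 / ((N : ℝ) + 1))) := by
    intro N
    -- Squaring makes N errors of size δ add up to at most 1/(N + 1).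
    have hδ : (0 : ℝ) < 1 / ((N : ℝ) + 1) ^ 2 := by positivity
    set δ : ℝ := 1 / ((N : ℝ) + 1) ^ 2
    have hNδ : N * δ ≤ 1 / ((N : ℝ) + 1) := by
      rw [mul_one_div, div_le_div_iff₀ (by positivity) (by positivity)]
      nlinarith [(Nat.cast_nonneg N : (0 : ℝ) ≤ N)]
    choose φ hφ using fun n =>
      exists_lipB_integral_abs_sub_indicator_le (hA n) (μ n + μ 0) hδ
    have hint : ∀ n k, Integrable
        (fun x => |(φ n : X → ℝ) x - (A n).indicator (fun _ => (1 : ℝ)) x|) (μ k) := fun n k =>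
      ((integrable_lipB (φ n) (μ k)).sub (integrable_indicator_one (hA n) (μ k))).abs
    have hφn : ∀ n, ∫ x, |(φ n : X → ℝ) x - (A n).indicator (fun _ => (1 : ℝ)) x| ∂(μ n) ≤ δ ∧
        ∫ x, |(φ n : X → ℝ) x - (A n).indicator (fun _ => (1 : ℝ)) x| ∂(μ 0) ≤ δ := by
      intro n
      have h1 := hφ n
      rw [integral_add_measure (hint n n) (hint n 0)] at h1
      have h2 : ∀ k, 0 ≤ ∫ x, |(φ n : X → ℝ) x - (A n).indicator (fun _ => (1 : ℝ)) x| ∂(μ k) :=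
        fun k => integral_nonneg fun x => abs_nonneg _
      constructor <;> linarith [h2 n, h2 0]
    have hpiece : ∀ n, |T (LipB.mul f (φ n)) π| ≤
        K * (∫ x in A n, |(f : X → ℝ) x| ∂(μ n) + M * δ) := by
      intro n
      refine (h n _ π K hK).trans (mul_le_mul_of_nonneg_left ?_ K.coe_nonneg)
      have hif := (integrable_abs_lipB f (μ n)).indicator (hA n)
      refine (integral_mono (integrable_abs_lipB _ _) (hif.add ((hint n n).const_mul M))
        fun x => ?_).trans ?_
      · simp only [LipB.mul_apply, Pi.add_apply]
        by_cases hx : x ∈ A n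
        · simp only [Set.indicator_of_mem hx, abs_mul]
          have h1 := abs_add_le ((φ n : X → ℝ) x - 1) 1
          rw [sub_add_cancel, abs_one] at h1
          nlinarith [hM x, abs_nonneg ((f : X → ℝ) x), abs_nonneg ((φ n : X → ℝ) x - 1)]
        · simp only [Set.indicator_of_notMem hx, abs_mul, sub_zero, zero_add]
          exact mul_le_mul_of_nonneg_right (hM x) (abs_nonneg _)
      · rw [integral_add' hif ((hint n n).const_mul M), integral_indicator (hA n),
          integral_const_mul]
        gcongr
        exact (hφn n).1
    have hrest : |T (f - ∑ n ∈ Finset.range N, LipB.mul f (φ n)) π| ≤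
        K * (M * ((μ 0).real Set.univ - ∑ n ∈ Finset.range N, (μ 0).real (A n) + N * δ)) := by
      refine (h 0 _ π K hK).trans (mul_le_mul_of_nonneg_left ?_ K.coe_nonneg)
      have hval : ∀ x, ((f - ∑ n ∈ Finset.range N, LipB.mul f (φ n) : LipB X) : X → ℝ) x =
          (f : X → ℝ) x * (1 - ∑ n ∈ Finset.range N, (φ n : X → ℝ) x) := by
        intro x
        simp [LipB.mul_apply, mul_sub, Finset.mul_sum]
      simp only [hval]
      have hi1 : Integrable (fun x => 1 - ∑ n ∈ Finset.range N,
          (A n).indicator (fun _ => (1 : ℝ)) x) (μ 0) :=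
        (integrable_const _).sub
          (integrable_finsetSum _ fun n _ => integrable_indicator_one (hA n) _)
      have hi2 : Integrable (fun x => ∑ n ∈ Finset.range N,
          |(φ n : X → ℝ) x - (A n).indicator (fun _ => (1 : ℝ)) x|) (μ 0) :=
        integrable_finsetSum _ fun n _ => hint n 0
      refine (abs_integral_mul_le hM (hi1.add hi2) fun x => ?_).trans ?_
      · have h1 : ∑ n ∈ Finset.range N, (A n).indicator (fun _ => (1 : ℝ)) x ≤ 1 := by
          rw [← Finset.indicator_biUnion_apply _ _ fun i _ j _ hij => hdisj hij]
          exact Set.indicator_le_self' (fun _ _ => zero_le_one) x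
        have h2 : 1 - ∑ n ∈ Finset.range N, (φ n : X → ℝ) x =
            (1 - ∑ n ∈ Finset.range N, (A n).indicator (fun _ => (1 : ℝ)) x) -
            ∑ n ∈ Finset.range N,
              ((φ n : X → ℝ) x - (A n).indicator (fun _ => (1 : ℝ)) x) := by
          rw [Finset.sum_sub_distrib]
          ring
        rw [h2]
        refine (abs_sub _ _).trans (add_le_add (abs_of_nonneg (sub_nonneg.2 h1)).le ?_)
        exact Finset.abs_sum_le_sum_abs _ _
      · refine mul_le_mul_of_nonneg_left ?_ hM0
        rw [integral_add' hi1 hi2, integral_sub (integrable_const _)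
          (integrable_finsetSum _ fun n _ => integrable_indicator_one (hA n) _),
          integral_finsetSum _ fun n _ => integrable_indicator_one (hA n) _,
          integral_finsetSum _ fun n _ => hint n 0]
        simp only [integral_indicator_const _ (hA _), integral_const, smul_eq_mul, mul_one]
        gcongr
        refine (Finset.sum_le_sum fun n _ => (hφn n).2).trans_eq ?_
        simp
    have hsplit : T f π = ∑ n ∈ Finset.range N, T (LipB.mul f (φ n)) π
        + T (f - ∑ n ∈ Finset.range N, LipB.mul f (φ n)) π := by
      simp
    rw [hsplit]
    have hpartial : ∑ n ∈ Finset.range N, ∫ x in A n, |(f : X → ℝ) x| ∂(μ n) ≤ I :=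
      sum_le_hasSum _ (fun n _ => integral_nonneg fun x => abs_nonneg _) hI
    calc _ ≤ ∑ n ∈ Finset.range N, K * (∫ x in A n, |(f : X → ℝ) x| ∂(μ n) + M * δ) +
          K * (M * ((μ 0).real Set.univ - ∑ n ∈ Finset.range N, (μ 0).real (A n) + N * δ)) :=
          (abs_add_le _ _).trans (add_le_add ((Finset.abs_sum_le_sum_abs _ _).trans
            (Finset.sum_le_sum fun n _ => hpiece n)) hrest)
      _ = K * (∑ n ∈ Finset.range N, ∫ x in A n, |(f : X → ℝ) x| ∂(μ n) + M * (N * δ) +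
          M * ((μ 0).real Set.univ - ∑ n ∈ Finset.range N, (μ 0).real (A n) + N * δ)) := by
          rw [← Finset.mul_sum, Finset.sum_add_distrib, Finset.sum_const, Finset.card_range,
            nsmul_eq_mul]
          ring
      _ ≤ _ := by gcongr
  have hlim : Tendsto (fun N : ℕ => K * (I + M * (1 / ((N : ℝ) + 1))
      + M * ((μ 0).real Set.univ - ∑ n ∈ Finset.range N, (μ 0).real (A n)
        + 1 / ((N : ℝ) + 1)))) atTop (𝓝 (K * (I + M * 0
      + M * ((μ 0).real Set.univ - (μ 0).real Set.univ + 0)))) := by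
    have h1 : HasSum (fun n => (μ 0).real (A n)) ((μ 0).real Set.univ) := by
      rw [← hcover]
      rw [Measure.real, measure_iUnion hdisj hA, ENNReal.tsum_toReal_eq fun n => measure_ne_top _ _]
      exact (ENNReal.summable_toReal (by
        rw [← measure_iUnion hdisj hA]; exact measure_ne_top _ _)).hasSum
    have h0 := tendsto_one_div_add_atTop_nhds_zero_nat (𝕜 := ℝ)
    exact (((h0.const_mul M).const_add I).add
      (((h1.tendsto_sum_nat.const_sub _).add h0).const_mul M)).const_mul (K : ℝ)
  refine (ge_of_tendsto' hlim hbound).trans_eq ?_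
  ring

/-- The infimum of measures evaluates X by covering it with sets t_n and choosing the cheapest
measure on each. Near-optimal choices μ_n, restricted to disjoint measurable pieces and glued, still
bound T. -/
theorem IsCurrent.exists_massBound_le {T : Functional X} (hT : IsCurrent T) {ε : ℝ} (hε : 0 < ε) :
    ∃ μ : Measure X, IsFiniteMeasure μ ∧ MassBound T μ ∧
      μ Set.univ ≤ mass T + ENNReal.ofReal ε := by
  obtain ⟨ν, hν, hνT⟩ := hT.finite_mass
  have hne : {μ : Measure X | IsFiniteMeasure μ ∧ MassBound T μ}.Nonempty := ⟨ν, hν, hνT⟩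
  have hfin : mass T < ∞ := (massMeasure_le hν hνT Set.univ).trans_lt hν.1
  have hε2 : ENNReal.ofReal (ε / 2) ≠ 0 := (ENNReal.ofReal_pos.2 (half_pos hε)).ne'
  have hlt := ENNReal.lt_add_right hfin.ne hε2
  nth_rewrite 1 [mass, massMeasure] at hlt
  rw [Measure.sInf_apply .univ, OuterMeasure.sInf_apply (hne.image _)] at hlt
  simp only [iInf_lt_iff] at hlt
  obtain ⟨t, htU, ht⟩ := hlt
  obtain ⟨η, hη, hηsum⟩ := ENNReal.exists_pos_sum_of_countable' hε2 ℕ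
  have hterm : ∀ n, ∃ μ : Measure X, IsFiniteMeasure μ ∧ MassBound T μ ∧
      μ (t n) ≤ (⨅ κ ∈ Measure.toOuterMeasure ''
        {μ : Measure X | IsFiniteMeasure μ ∧ MassBound T μ}, κ (t n)) + η n := by
    intro n
    have hlt := ENNReal.lt_add_right (((ENNReal.le_tsum n).trans_lt ht).trans (by
      exact ENNReal.add_lt_top.2 ⟨hfin, ENNReal.ofReal_lt_top⟩)).ne (hη n).ne'
    rw [iInf_lt_iff] at hlt
    obtain ⟨κ, hκ⟩ := hlt
    rw [iInf_lt_iff] at hκ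
    obtain ⟨⟨μ, ⟨hμ, hμT⟩, rfl⟩, hκ⟩ := hκ
    exact ⟨μ, hμ, hμT, hκ.le⟩
  choose μ hμ hμT hμt using hterm
  -- The t_n need not be measurable; the measurable hull with respect to μ_n does not increase
  -- μ_n(t_n).
  let B : ℕ → Set X := fun n => toMeasurable (μ n) (t n)
  have hsum : (Measure.sum fun n => (μ n).restrict (disjointed B n)) Set.univ ≤
      mass T + ENNReal.ofReal ε := by
    rw [Measure.sum_apply _ .univ]
    calc _ ≤ ∑' n, ((⨅ κ ∈ Measure.toOuterMeasure ''
            {μ : Measure X | IsFiniteMeasure μ ∧ MassBound T μ}, κ (t n)) + η n) := by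
          refine ENNReal.tsum_le_tsum fun n => ?_
          rw [Measure.restrict_apply_univ]
          refine le_trans ?_ (hμt n)
          rw [← measure_toMeasurable (μ := μ n) (t n)]
          exact measure_mono (disjointed_subset B n)
      _ ≤ (mass T + ENNReal.ofReal (ε / 2)) + ENNReal.ofReal (ε / 2) := by
          rw [ENNReal.tsum_add]
          exact add_le_add ht.le hηsum.le
      _ = _ := by
          rw [add_assoc, ← ENNReal.ofReal_add (by positivity) (by positivity), add_halves]
  have hF : IsFiniteMeasure (Measure.sum fun n => (μ n).restrict (disjointed B n)) :=
    ⟨hsum.trans_lt (ENNReal.add_lt_top.2 ⟨hfin, ENNReal.ofReal_lt_top⟩)⟩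
  refine ⟨_, hF, MassBound.glue hμT
    (fun n => MeasurableSet.disjointed (fun n => measurableSet_toMeasurable _ _) n)
    (disjoint_disjointed B) ?_ hF, hsum⟩
  rw [iUnion_disjointed]
  exact Set.univ_subset_iff.1 (htU.trans (Set.iUnion_mono fun n => subset_toMeasurable _ _))

end MassMeasure

/-! ### The Kantorovich–Rubinstein norm as a Lipschitz bound on the boundary. -/

section Boundary

variable {X : Type*} [MetricSpace X] [MeasurableSpace X] [BorelSpace X]

theorem IsCurrent.krBoundary_lt_top {T : Functional X} (hT : IsCurrent T) : krBoundary T < ∞ := by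
  obtain ⟨μ, hμ, h⟩ := hT.finite_mass
  refine lt_of_le_of_lt (iSup₂_le fun f hf => ?_)
    (ENNReal.ofReal_lt_top (r := ((1 : ℝ≥0) : ℝ) * ∫ x, |(oneB X : X → ℝ) x| ∂μ))
  exact ENNReal.ofReal_le_ofReal ((le_abs_self _).trans (h _ f 1 hf))

theorem IsCurrent.lipBound_krBoundary {T : Functional X} (hT : IsCurrent T) :
    LipBound (T (oneB X)) (krBoundary T).toReal := by
  have hle : ∀ f : Lip X, LipschitzWith 1 (f : X → ℝ) → T (oneB X) f ≤ (krBoundary T).toReal :=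
    fun f hf => (ENNReal.ofReal_le_iff_le_toReal hT.krBoundary_lt_top.ne).1
      (le_iSup₂ (f := fun (f : Lip X) (_ : LipschitzWith 1 (f : X → ℝ)) =>
        ENNReal.ofReal (T (oneB X) f)) f hf)
  have habs : ∀ f : Lip X, LipschitzWith 1 (f : X → ℝ) →
      |T (oneB X) f| ≤ (krBoundary T).toReal := fun f hf => abs_le.2
    ⟨by have := hle (-f) hf.neg; rw [map_neg] at this; linarith, hle f hf⟩
  obtain ⟨μ, hμ, h⟩ := hT.finite_mass
  intro f K hf
  have hB : LipBound (T (oneB X)) (∫ x, |(oneB X : X → ℝ) x| ∂μ) := fun g L hg =>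
    (h _ g L hg).trans_eq (mul_comm _ _)
  -- With no points the vanishing condition is void, and the lemma is just homogeneity from
  -- 1-Lipschitz functions.
  exact hB.le_of_vanishing (n := 0) (p := Fin.elim0) (fun g hg _ => habs g hg) hf
    fun i => i.elim0

end Boundary

end MetricCurrents

end

/-! ### Decomposition into a cycle and a rectifiable current. -/

theorem mainTheorem5 {X : Type*} [MetricSpace X] [TopologicalSpace.SeparableSpace X]
    [MeasurableSpace X] [BorelSpace X] (c : ℝ)
    (hX : MetricCurrents.PiecewiseQuasiconvex X c)
    (T : MetricCurrents.Functional X) (hT : MetricCurrents.IsCurrent T)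
    (ε : ℝ) (hε : 0 < ε) :
    ∃ C R : MetricCurrents.Functional X,
      MetricCurrents.IsCurrent C ∧
      MetricCurrents.IsRectifiableCurrent R ∧
      MetricCurrents.boundary C = 0 ∧
      T = C + R ∧
      MetricCurrents.mass C ≤ MetricCurrents.mass T
        + ENNReal.ofReal c * MetricCurrents.krBoundary T + ENNReal.ofReal ε ∧
      MetricCurrents.mass R ≤
        ENNReal.ofReal c * MetricCurrents.krBoundary T + ENNReal.ofReal ε := by
  open MetricCurrents in
  have hc : 0 ≤ c := zero_le_one.trans hX.1
  obtain ⟨R, μ, hR, hμ, hRT⟩ : ∃ (R : Functional X) (μ : MeasureTheory.Measure X),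
      IsRectifiableWith R μ ∧ μ Set.univ ≤ ENNReal.ofReal (c * (krBoundary T).toReal)
        + ENNReal.ofReal (ε / 2) ∧ R (oneB X) = T (oneB X) := by
    -- A dense sequence requires a point; on the empty space the empty sum of currents serves as R.
    rcases isEmpty_or_nonempty X with hemp | hne
    · obtain ⟨R, hR, hsum⟩ := exists_hasSum_isRectifiableWith (X := X) (ι := Empty)
        (R := Empty.elim) (μ := Empty.elim) (fun i => i.elim) (by simp)
      refine ⟨R, _, hR, by simp, LinearMap.ext fun f => ?_⟩
      rw [Subsingleton.elim f 0, map_zero, map_zero]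
    · exact hX.exists_filling (TopologicalSpace.denseRange_denseSeq X) hT.lipContinuous_oneB
        ENNReal.toReal_nonneg hT.lipBound_krBoundary (half_pos hε)
  rw [ENNReal.ofReal_mul hc, ENNReal.ofReal_toReal hT.krBoundary_lt_top.ne] at hμ
  -- Half of ε was spent on the filling; the other half goes to a nearly minimal bounding measure
  -- for T.
  obtain ⟨ν, hν, hνT, hνle⟩ := hT.exists_massBound_le (half_pos hε)
  have hC : T - R = T + (-1 : ℝ) • R := by
    refine LinearMap.ext₂ fun f π => ?_
    simp [sub_eq_add_neg]
  have hsmul := hR.smul (-1)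
  have hfin := hsmul.isFinite
  have hmassR : mass R ≤ μ Set.univ := massMeasure_le hR.isFinite hR.massBound _
  refine ⟨T - R, R, ?_, hR.isRectifiableCurrent, ?_, (sub_add_cancel T R).symm, ?_, ?_⟩
  · rw [hC]
    exact hT.add hsmul.isCurrent
  · ext f
    simp [boundary, hRT]
  · rw [hC]
    refine (massMeasure_le (inferInstance : MeasureTheory.IsFiniteMeasure
      (ν + ‖(-1 : ℝ)‖ₑ • μ)) (hνT.add hsmul.massBound) _).trans ?_
    rw [MeasureTheory.Measure.add_apply, MeasureTheory.Measure.smul_apply, enorm_neg, enorm_one,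
      one_smul]
    refine (add_le_add hνle hμ).trans_eq ?_
    rw [add_add_add_comm, ← ENNReal.ofReal_add (by positivity) (by positivity), add_halves]
  · refine (hmassR.trans hμ).trans ?_
    gcongr
    linarith
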